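/- Let $C\subset\mathbb R^2$ be the closed disc with center $(a,b)\in\mathbb R^2$ and radius $r>0$, let $C_i=\{iX : X\in C\}$ for $i\in\mathbb N$ (with $0\in\mathbb N$), and let $\mathcal S=\bigcup_{i\ge 0} C_i\cap\mathbb N^2$, which is a submonoid of $\mathbb N^2$. Let $L=\{\sum_{j} q_ja_j : q_j\in\mathbb Q_{\ge 0},\ a_j\in C\cap\mathbb R^2_{\ge}\}$ (finite sums) be the cone generated by $C\cap\mathbb R^2_{\ge}$, and let $\mathcal C=L\cap\mathbb N^2$. A line $\tau$ through the origin is called an extremal ray of $L$ if $L\cap\tau\neq\{0\}$ and if $X,Y\in L$, $X+Y\in\tau$ imply $X,Y\in\tau$. (1) If $C\cap\mathbb R^2_{\ge}=\emptyset$, then $\mathcal S=\{0\}$. (2) Suppose that $L$ has two extremal rays $\tau_1,\tau_2$, the slope of $\tau_1$ being greater than the slope of $\tau_2$ (a vertical line has slope $\infty$). Then $\mathcal S$ is finitely generated if and only if both $C\cap\tau_1$ and $C\cap\tau_2$ contain a point with rational coordinates. In such case $\mathcal S\subseteq\mathcal C$, and only finitely many points of $\mathcal C\setminus(\tau_1\cup\tau_2)$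 do not belong to $\mathcal S$; that is, $\mathcal S$ is obtained from $\mathcal C$ by removing finitely many interior points and some points of the extremal rays. (3) The minimal system of generators of $\mathcal S$ can be computed algorithmically. There is one algorithm which, for all real $a,b$ and $r>0$ such that $C\cap\mathbb R^2_{\ge}=\emptyset$ or $L$ has two extremal rays as in (2), and such that $\mathcal S$ is finitely generated, halts on the input $(a,b,r)$ and outputs a finite list of the elements of the minimal system of generators of $\mathcal S$, i.e. of a set that generates $\mathcal S$ and has no proper subset generating $\mathcal S$. Here an algorithm on real input is a computable (Turing) procedure which has access to the input through exact comparisons: it may ask, adaptively, whether $p(a,b,r)\ge 0$ for polynomials $p$ with integer coefficients (computation over the reals in the sense of Blum, Shub and Smale, without real constants). -/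

import Mathlib

noncomputable section

/-- The Euclidean plane. -/
abbrev Plane : Type := EuclideanSpace ℝ (Fin 2)

/-- The closed quadrant of points with non-negative coordinates. -/
def quadrant : Set Plane := {X | 0 ≤ X 0 ∧ 0 ≤ X 1}

/-- A lattice point of `ℕ²` seen in the plane. -/
def latticePoint (n : ℕ × ℕ) : Plane := !₂[(n.1 : ℝ), (n.2 : ℝ)]

lemma latticePoint_zero : latticePoint 0 = 0 := by
  ext i; fin_cases i <;> simp [latticePoint]

lemma latticePoint_add (m n : ℕ × ℕ) :
    latticePoint (m + n) = latticePoint m + latticePoint n := by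
  ext i; fin_cases i <;> simp [latticePoint]

/-- The closed disc with center `(a, b)` and radius `r`. -/
def disc (a b r : ℝ) : Set Plane := Metric.closedBall !₂[a, b] r

/-- The semigroup `⋃ i, (i • C) ∩ ℕ²` generated by the disc `C` with center `(a, b)` and
radius `r`. -/
def discSemigroup (a b r : ℝ) (hr : 0 < r) : AddSubmonoid (ℕ × ℕ) where
  carrier := {n | ∃ i : ℕ, ∃ X ∈ disc a b r, latticePoint n = (i : ℝ) • X}
  zero_mem' := ⟨0, !₂[a, b], Metric.mem_closedBall_self hr.le, by simp [latticePoint_zero]⟩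
  add_mem' := by
    rintro m n ⟨i, X, hX, hm⟩ ⟨j, Y, hY, hn⟩
    rcases Nat.eq_zero_or_pos (i + j) with h | h
    · obtain ⟨rfl, rfl⟩ : i = 0 ∧ j = 0 := by omega
      exact ⟨0, X, hX, by rw [latticePoint_add, hm, hn]; simp⟩
    · have h' : (0 : ℝ) < (i : ℝ) + j := by exact_mod_cast h
      refine ⟨i + j, ((i : ℝ) / (i + j)) • X + ((j : ℝ) / (i + j)) • Y,
        (convex_closedBall _ _) hX hY (by positivity) (by positivity) (by field_simp), ?_⟩
      rw [latticePoint_add, hm, hn, smul_add, smul_smul, smul_smul]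
      push_cast
      rw [mul_div_cancel₀ _ h'.ne', mul_div_cancel₀ _ h'.ne']

/-- The cone `{∑ qᵢ aᵢ | qᵢ ∈ ℚ, qᵢ ≥ 0, aᵢ ∈ A}` (finite sums) generated by `A`. -/
def rationalCone (A : Set Plane) : Submodule ℚ≥0 Plane := Submodule.span ℚ≥0 A

/-- The integer cone `L(C ∩ ℝ²≥) ∩ ℕ²` of the disc `C` with center `(a, b)` and radius `r`. -/
def integerCone (a b r : ℝ) : Set (ℕ × ℕ) :=
  {n | latticePoint n ∈ rationalCone (disc a b r ∩ quadrant)}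

/-- `τ` is an extremal ray of the cone `L`: a line through the origin which meets `L` outside the
origin and such that a sum of two elements of `L` lies on `τ` only if both summands do. (As usual
for cones in the quadrant, a ray is identified with the line that it spans.) -/
def IsExtremalRay (L : Submodule ℚ≥0 Plane) (τ : Submodule ℝ Plane) : Prop :=
  Module.finrank ℝ τ = 1 ∧ (∃ X ∈ L, X ∈ τ ∧ X ≠ 0) ∧
    ∀ X ∈ L, ∀ Y ∈ L, X + Y ∈ τ → X ∈ τ ∧ Y ∈ τ

/-- The slope of `τ₁` is greater than the slope of `τ₂`, for lines of slope in `[0, ∞]`. The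
slopes `u 1 / u 0` and `v 1 / v 0` are compared by cross-multiplication, so that a vertical line has
slope `∞`. -/
def SlopeGreater (τ₁ τ₂ : Submodule ℝ Plane) : Prop :=
  ∃ u ∈ τ₁, ∃ v ∈ τ₂, u ∈ quadrant ∧ v ∈ quadrant ∧ v 1 * u 0 < u 1 * v 0

/-- `τ₁` and `τ₂` are the extremal rays of `L(C ∩ ℝ²≥)`, that of greater slope being `τ₁`. -/
def AreExtremalRays (a b r : ℝ) (τ₁ τ₂ : Submodule ℝ Plane) : Prop :=
  IsExtremalRay (rationalCone (disc a b r ∩ quadrant)) τ₁ ∧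
  IsExtremalRay (rationalCone (disc a b r ∩ quadrant)) τ₂ ∧ SlopeGreater τ₁ τ₂

/-- The set `A` contains a point with rational coordinates. -/
def HasRationalPoint (A : Set Plane) : Prop :=
  ∃ p q : ℚ, (!₂[(p : ℝ), (q : ℝ)] : Plane) ∈ A

/-- `B` generates `S` and no proper subset of `B` does. -/
def IsMinimalGeneratingSystem (B : Set (ℕ × ℕ)) (S : AddSubmonoid (ℕ × ℕ)) : Prop :=
  AddSubmonoid.closure B = S ∧ ∀ B' : Set (ℕ × ℕ), B' ⊂ B → AddSubmonoid.closure B' ≠ S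

/-! ### Algorithms on discs with real parameters

An algorithm is a computable interactive procedure. The parameters `(a, b, r)` are accessible
through exact comparisons only: the procedure may ask whether `p(a, b, r) ≥ 0`, where `p` is a
polynomial with integer coefficients. This is computation over the reals in the sense of Blum, Shub
and Smale, without real constants: branchings there are decided by the signs of rational functions
of the input with rational coefficients, that is, by signs of integer polynomials. -/

/-- A polynomial in three variables with integer coefficients, as a list of monomials:
`(c, i, j, k)` stands for `c * x ^ i * y ^ j * z ^ k`. -/
abbrev IntPoly : Type := List (ℤ × ℕ × ℕ × ℕ)

/-- The value of an integer polynomial at `(a, b, r)`. -/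
def IntPoly.value (p : IntPoly) (a b r : ℝ) : ℝ :=
  (p.map fun m => (m.1 : ℝ) * a ^ m.2.1 * b ^ m.2.2.1 * r ^ m.2.2.2).sum

/-- The answer to the question whether `p(a, b, r) ≥ 0`. -/
def IntPoly.answer (p : IntPoly) (a b r : ℝ) : Bool := decide (0 ≤ p.value a b r)

/-- The control of an interactive procedure: from the answers received so far (the latest one
first) it determines either the next question or the final output, a finite list of lattice
points. -/
abbrev Procedure : Type := List Bool → IntPoly ⊕ List (ℕ × ℕ)

/-- The lists of answers that the procedure receives in its run on the input `(a, b, r)`. -/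
inductive Procedure.Reaches (M : Procedure) (a b r : ℝ) : List Bool → Prop
  | start : Procedure.Reaches M a b r []
  | ask (h : List Bool) (p : IntPoly) : Procedure.Reaches M a b r h → M h = Sum.inl p →
      Procedure.Reaches M a b r (p.answer a b r :: h)

/-- On the input `(a, b, r)` the procedure halts with output `l`. -/
def Procedure.Outputs (M : Procedure) (a b r : ℝ) (l : List (ℕ × ℕ)) : Prop :=
  ∃ h : List Bool, M.Reaches a b r h ∧ M h = Sum.inr l

end

/-!
The lattice point `(x, y)` lies in the `i`-th dilate of the disc if and only if the quadratic form
`q(x, y, i) = i² r² - ‖(x, y) - i (a, b)‖²` is non-negative. Suppose that `u` and `v` span the two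
extremal rays and lie in the semigroup, at heights `i` and `j`. Then `s u + t v` satisfies
`q ≥ 2 s t B` at the real height `s i + t j`, where `B > 0` is the polar form of the pair, while
rounding the height to an integer costs at most `|k|`, `k = a² + b² - r²`. Hence all lattice points
with `s t` large lie in the semigroup. It follows that far out along a ray one can subtract `u`
(or `v`) without leaving the semigroup; on the ray itself this holds because either the line is
tangent to the disc, which forces the heights, or the line is an axis and meets the interior of the
disc. So the irreducible elements lie in an explicit box, and they form the minimal system of
generators. Conversely, if the semigroup is finitely generated and does not meet an extremal ray, it
is contained in a strictly smaller cone, although rational points of the disc come arbitrarily close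
to the ray.

That a given list consists of the irreducible elements is certified by finitely many sign conditions
on integer polynomials in `(a, b, r)`: for a non-member of the semigroup with `k ≥ 0` only finitely
many heights matter. The algorithm asks all questions one after the other and tries all candidates
for the list until one of them is certified.
-/

open Filter Topology

section Irreducibles

variable {M : Type*}

instance subsingleton_addUnits_addSubmonoid [AddMonoid M] [Subsingleton (AddUnits M)]
    (S : AddSubmonoid M) : Subsingleton (AddUnits S) :=
  (AddUnits.map_injective (f := S.subtype) Subtype.val_injective).subsingleton

/-- The irreducible elements of the monoid `S`, seen in the ambient monoid. -/
def irreducibles [AddMonoid M] (S : AddSubmonoid M) : Set M := (↑) '' {x : S | AddIrreducible x}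

lemma mem_irreducibles_iff [AddMonoid M] [Subsingleton (AddUnits M)] {S : AddSubmonoid M}
    {n : M} : n ∈ irreducibles S ↔
      n ∈ S ∧ n ≠ 0 ∧ ∀ x ∈ S, ∀ y ∈ S, n = x + y → x = 0 ∨ y = 0 := by
  simp only [irreducibles, Set.mem_image, Set.mem_ofPred_eq, Subtype.exists, exists_and_right,
    exists_eq_right, addIrreducible_iff, isAddUnit_iff_eq_zero, Subtype.forall, Subtype.ext_iff,
    AddSubmonoid.coe_zero, AddSubmonoid.coe_add, exists_prop, ne_eq]
  tauto

lemma irreducibles_bot [AddMonoid M] [Subsingleton (AddUnits M)] :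
    irreducibles (⊥ : AddSubmonoid M) = ∅ := by
  refine Set.eq_empty_of_forall_notMem fun n hn => ?_
  obtain ⟨hn, hn0, -⟩ := mem_irreducibles_iff.1 hn
  exact hn0 (AddSubmonoid.mem_bot.1 hn)

lemma irreducibles_subset_of_closure_eq [AddCommMonoid M] [Subsingleton (AddUnits M)]
    {S : AddSubmonoid M} {B : Set M} (h : AddSubmonoid.closure B = S) : irreducibles S ⊆ B := by
  subst h
  exact Set.image_subset_iff.2 <| addIrreducible_subset_of_addSubmonoidClosure_eq_top
    AddSubmonoid.closure_closure_coe_preimage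

lemma closure_irreducibles [AddCancelCommMonoid M] [Subsingleton (AddUnits M)]
    {S : AddSubmonoid M} (hS : S.FG) : AddSubmonoid.closure (irreducibles S) = S := by
  have := (AddMonoid.fg_iff_addSubmonoid_fg S).2 hS
  let _ : AddCancelCommMonoid S :=
    { add_left_cancel _ _ _ h := Subtype.ext (add_left_cancel (congrArg Subtype.val h)) }
  rw [irreducibles, ← AddSubmonoid.coe_subtype, ← AddMonoidHom.map_mclosure,
    AddSubmonoid.closure_addIrreducible, ← AddMonoidHom.mrange_eq_map, AddSubmonoid.mrange_subtype]

lemma finite_irreducibles [AddCommMonoid M] [Subsingleton (AddUnits M)] {S : AddSubmonoid M}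
    (hS : S.FG) : (irreducibles S).Finite :=
  let ⟨B, hB⟩ := hS
  B.finite_toSet.subset (irreducibles_subset_of_closure_eq hB)

lemma closure_eq_of_forall_exists_add [AddCommMonoid M] [PartialOrder M]
    [IsOrderedCancelAddMonoid M] [CanonicallyOrderedAdd M] [WellFoundedLT M] {S : AddSubmonoid M}
    {B : Set M} (hBS : B ⊆ S)
    (h : ∀ n ∈ S, n ∉ B → ∃ x ∈ S, ∃ y ∈ S, x ≠ 0 ∧ y ≠ 0 ∧ n = x + y) :
    AddSubmonoid.closure B = S := by
  refine le_antisymm (AddSubmonoid.closure_le.2 hBS) fun n => ?_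
  induction n using WellFoundedLT.induction with
  | ind n ih =>
    intro hn
    by_cases hnB : n ∈ B
    · exact AddSubmonoid.subset_closure hnB
    · obtain ⟨x, hx, y, hy, hx0, hy0, rfl⟩ := h n hn hnB
      exact add_mem (ih x (lt_add_of_pos_right x (pos_iff_ne_zero.2 hy0)) hx)
        (ih y (lt_add_of_pos_left y (pos_iff_ne_zero.2 hx0)) hy)

lemma isMinimalGeneratingSystem_irreducibles {S : AddSubmonoid (ℕ × ℕ)} (hS : S.FG) :
    IsMinimalGeneratingSystem (irreducibles S) S :=
  ⟨closure_irreducibles hS, fun _ hB h => hB.2 (irreducibles_subset_of_closure_eq h)⟩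

end Irreducibles

section DiscForm

/-- The quadratic form `q` of the cone over the disc with center `(a, b)` and radius `r`: for a
height `i ≥ 0` it is non-negative at `(x, y, i)` if and only if `(x, y)` lies in the `i`-th dilate
of the disc. -/
def discForm (a b r x y i : ℝ) : ℝ := i ^ 2 * r ^ 2 - (x - i * a) ^ 2 - (y - i * b) ^ 2

/-- The symmetric bilinear form with `discPolar z z = discForm z`. -/
def discPolar (a b r x y i x' y' i' : ℝ) : ℝ :=
  i * i' * r ^ 2 - (x - i * a) * (x' - i' * a) - (y - i * b) * (y' - i' * b)

variable {a b r x y i x' y' i' : ℝ}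

lemma discForm_swap (a b r x y i : ℝ) : discForm b a r y x i = discForm a b r x y i := by
  unfold discForm; ring

lemma discPolar_swap (a b r x y i x' y' i' : ℝ) :
    discPolar b a r y x i y' x' i' = discPolar a b r x y i x' y' i' := by
  unfold discPolar; ring

lemma discPolar_comm (a b r x y i x' y' i' : ℝ) :
    discPolar a b r x y i x' y' i' = discPolar a b r x' y' i' x y i := by
  unfold discPolar; ring

lemma discForm_smul (a b r x y i s : ℝ) :
    discForm a b r (s * x) (s * y) (s * i) = s ^ 2 * discForm a b r x y i := by
  unfold discForm; ring

lemma discForm_comb (a b r x y i x' y' i' s t : ℝ) :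
    discForm a b r (s * x + t * x') (s * y + t * y') (s * i + t * i') =
      s ^ 2 * discForm a b r x y i + t ^ 2 * discForm a b r x' y' i' +
        s * t * (2 * discPolar a b r x y i x' y' i') := by
  unfold discForm discPolar; ring

lemma discForm_convexComb (a b r x y x' y' t : ℝ) :
    discForm a b r ((1 - t) * x + t * x') ((1 - t) * y + t * y') 1 =
      (1 - t) * discForm a b r x y 1 + t * discForm a b r x' y' 1 +
        t * (1 - t) * ((x - x') ^ 2 + (y - y') ^ 2) := by
  unfold discForm; ring

lemma discForm_add_height (a b r x y t e : ℝ) :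
    discForm a b r x y (t + e) = discForm a b r x y t +
      2 * (e * (x * a + y * b - (a ^ 2 + b ^ 2 - r ^ 2) * t)) -
      e ^ 2 * (a ^ 2 + b ^ 2 - r ^ 2) := by
  unfold discForm; ring

lemma discForm_eq_height_mul_sub (a b r x y i : ℝ) :
    discForm a b r x y i =
      i * (2 * (x * a + y * b) - (a ^ 2 + b ^ 2 - r ^ 2) * i) - (x ^ 2 + y ^ 2) := by
  unfold discForm; ring

lemma continuous_discForm (a b r i : ℝ) : Continuous fun z : ℝ × ℝ => discForm a b r z.1 z.2 i := by
  unfold discForm; fun_prop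

/-- Rounding `t` in the direction in which the linear term does not decrease costs at most the
coefficient of the square. -/
lemma exists_nat_discForm_nonneg {t : ℝ} (ht : 0 ≤ t)
    (h : |a ^ 2 + b ^ 2 - r ^ 2| ≤ discForm a b r x y t) : ∃ i : ℕ, 0 ≤ discForm a b r x y i := by
  set g := x * a + y * b - (a ^ 2 + b ^ 2 - r ^ 2) * t with hg
  have of_rounding : ∀ i : ℕ, ((i : ℝ) - t) ^ 2 ≤ 1 → 0 ≤ ((i : ℝ) - t) * g →
      0 ≤ discForm a b r x y i := by
    intro i hi hslope
    have hquad : ((i : ℝ) - t) ^ 2 * (a ^ 2 + b ^ 2 - r ^ 2) ≤ |a ^ 2 + b ^ 2 - r ^ 2| :=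
      (mul_le_mul_of_nonneg_left (le_abs_self _) (sq_nonneg _)).trans
        (mul_le_of_le_one_left (abs_nonneg _) hi)
    have := discForm_add_height a b r x y t (i - t)
    rw [add_sub_cancel, ← hg] at this
    linarith
  have hfloor := Nat.floor_le ht
  have hceil := Nat.le_ceil t
  rcases le_total 0 g with hg0 | hg0
  · refine ⟨⌈t⌉₊, of_rounding _ ?_ (mul_nonneg (sub_nonneg.2 hceil) hg0)⟩
    nlinarith [Nat.ceil_lt_add_one ht]
  · refine ⟨⌊t⌋₊, of_rounding _ ?_ (mul_nonneg_of_nonpos_of_nonpos (sub_nonpos.2 hfloor) hg0)⟩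
    nlinarith [Nat.lt_floor_add_one t]

lemma height_pos_of_discForm_nonneg (h : 0 ≤ discForm a b r x y i) (hi : 0 ≤ i)
    (hxy : 0 < x ^ 2 + y ^ 2) : 0 < i := by
  refine hi.lt_of_ne ?_
  rintro rfl
  unfold discForm at h
  linarith

lemma discPolar_pos (hi : 0 < i) (hi' : 0 < i') (h : 0 ≤ discForm a b r x y i)
    (h' : 0 ≤ discForm a b r x' y' i') (hne : x * y' ≠ y * x') :
    0 < discPolar a b r x y i x' y' i' := by
  have hdiff : 0 < (i' * x - i * x') ^ 2 + (i' * y - i * y') ^ 2 := by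
    by_contra hcon
    have hx : i' * x - i * x' = 0 := by nlinarith
    have hy : i' * y - i * y' = 0 := by nlinarith
    have : i' * (x * y' - y * x') = 0 := by linear_combination y' * hx - x' * hy
    exact hne (sub_eq_zero.1 ((mul_eq_zero.1 this).resolve_left hi'.ne'))
  have hpolarization : 2 * (i * i') * discPolar a b r x y i x' y' i' =
      i' ^ 2 * discForm a b r x y i + i ^ 2 * discForm a b r x' y' i' +
        ((i' * x - i * x') ^ 2 + (i' * y - i * y') ^ 2) := by
    unfold discForm discPolar; ring
  have : 0 < 2 * (i * i') * discPolar a b r x y i x' y' i' := by rw [hpolarization]; positivity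
  exact pos_of_mul_pos_right this (by positivity)

end DiscForm

section DiscSemigroup

variable {a b r : ℝ}

lemma mem_disc_iff (hr : 0 ≤ r) {X : Plane} :
    X ∈ disc a b r ↔ 0 ≤ discForm a b r (X 0) (X 1) 1 := by
  rw [disc, Metric.mem_closedBall, EuclideanSpace.dist_eq, Real.sqrt_le_left hr, discForm,
    Fin.sum_univ_two, Real.dist_eq, Real.dist_eq, sq_abs, sq_abs]
  simp only [Matrix.cons_val_zero, Matrix.cons_val_one, one_pow, one_mul]
  constructor <;> intro h <;> linarith

lemma latticePoint_eq_smul_iff {n : ℕ × ℕ} {c : ℝ} {X : Plane} :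
    latticePoint n = c • X ↔ (n.1 : ℝ) = c * X 0 ∧ (n.2 : ℝ) = c * X 1 := by
  simp [PiLp.ext_iff, latticePoint]

lemma discForm_smul_one (a b r x y s : ℝ) :
    discForm a b r (s * x) (s * y) s = s ^ 2 * discForm a b r x y 1 := by
  rw [← discForm_smul, mul_one]

lemma discForm_smul_one_nonneg_iff {x y s : ℝ} (hs : 0 < s) :
    0 ≤ discForm a b r (s * x) (s * y) s ↔ 0 ≤ discForm a b r x y 1 := by
  rw [discForm_smul_one, mul_nonneg_iff_of_pos_left (by positivity)]

lemma mem_discSemigroup_iff {hr : 0 < r} {n : ℕ × ℕ} :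
    n ∈ discSemigroup a b r hr ↔ ∃ i : ℕ, 0 ≤ discForm a b r n.1 n.2 i := by
  refine exists_congr fun i => ?_
  simp only [latticePoint_eq_smul_iff, mem_disc_iff hr.le]
  constructor
  · rintro ⟨X, hX, h0, h1⟩
    rw [h0, h1, discForm_smul_one]
    positivity
  · intro h
    rcases Nat.eq_zero_or_pos i with rfl | hi
    · have : (n.1 : ℝ) = 0 ∧ (n.2 : ℝ) = 0 := by
        constructor <;> simp [discForm] at h <;> nlinarith
      exact ⟨!₂[a, b], by simpa [discForm] using sq_nonneg r, by simpa using this⟩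
    · have hi' : (0 : ℝ) < i := by exact_mod_cast hi
      refine ⟨!₂[(n.1 : ℝ) / i, (n.2 : ℝ) / i], ?_, ?_⟩
      · rw [← discForm_smul_one_nonneg_iff hi']
        simpa [mul_div_cancel₀ _ hi'.ne'] using h
      · simp [mul_div_cancel₀ _ hi'.ne']

lemma exists_mem_disc_inter_quadrant {hr : 0 < r} {n : ℕ × ℕ} (hn : n ∈ discSemigroup a b r hr)
    (h0 : n ≠ 0) : ∃ i : ℕ, 0 < i ∧ ∃ X ∈ disc a b r ∩ quadrant, latticePoint n = (i : ℝ) • X := by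
  obtain ⟨i, X, hX, hn⟩ := hn
  have hcoord := latticePoint_eq_smul_iff.1 hn
  have hi : 0 < i := by
    refine Nat.pos_of_ne_zero ?_
    rintro rfl
    exact h0 (Prod.ext (by simpa using hcoord.1) (by simpa using hcoord.2))
  have hi' : (0 : ℝ) < i := by exact_mod_cast hi
  exact ⟨i, hi, X, ⟨hX, nonneg_of_mul_nonneg_right (hcoord.1 ▸ Nat.cast_nonneg _) hi',
    nonneg_of_mul_nonneg_right (hcoord.2 ▸ Nat.cast_nonneg _) hi'⟩, hn⟩

lemma discSemigroup_eq_bot (hr : 0 < r) (h : disc a b r ∩ quadrant = ∅) :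
    discSemigroup a b r hr = ⊥ := by
  refine (AddSubmonoid.eq_bot_iff_forall _).2 fun n hn => ?_
  by_contra h0
  obtain ⟨-, -, X, hX, -⟩ := exists_mem_disc_inter_quadrant hn h0
  exact (h ▸ hX : X ∈ (∅ : Set Plane))

lemma discSemigroup_subset_integerCone (hr : 0 < r) :
    (discSemigroup a b r hr : Set (ℕ × ℕ)) ⊆ integerCone a b r := by
  intro n hn
  change latticePoint n ∈ rationalCone (disc a b r ∩ quadrant)
  rcases eq_or_ne n 0 with rfl | h0
  · rw [latticePoint_zero]
    exact zero_mem _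
  · obtain ⟨i, -, X, hX, hn⟩ := exists_mem_disc_inter_quadrant hn h0
    rw [hn, Nat.cast_smul_eq_nsmul]
    exact nsmul_mem (Submodule.subset_span hX) i

lemma map_prodComm_discSemigroup (a b : ℝ) {r : ℝ} (hr : 0 < r) :
    (discSemigroup a b r hr).map (AddEquiv.prodComm : ℕ × ℕ ≃+ ℕ × ℕ).toAddMonoidHom =
      discSemigroup b a r hr := by
  ext n
  rw [AddSubmonoid.mem_map_equiv, mem_discSemigroup_iff, mem_discSemigroup_iff]
  simp only [AddEquiv.coe_prodComm_symm, Prod.fst_swap, Prod.snd_swap, discForm_swap]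

end DiscSemigroup

section Edges

variable {a b r : ℝ}

/-- The lattice vector `u` lies in the semigroup, at height `i`, and bounds it on the left. Either
`u` spans a line that is tangent to the disc or misses it, or `u` lies on the vertical axis and is
well inside of the cone over the disc. The constant `N` says how far out on the ray of `u` one has
to be for subtracting `u` not to lead out of the semigroup. -/
structure IsLeftEdge (a b r : ℝ) (u : ℕ × ℕ) (i N : ℕ) : Prop where
  mem : 0 ≤ discForm a b r u.1 u.2 i
  snd_pos : 0 < u.2
  tangent_or_interior :
    (0 ≤ u.2 * a - u.1 * b ∧ r ^ 2 * ((u.1 : ℝ) ^ 2 + u.2 ^ 2) ≤ (u.2 * a - u.1 * b) ^ 2) ∨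
      (u.1 = 0 ∧ |a ^ 2 + b ^ 2 - r ^ 2| ≤ N * discForm a b r u.1 u.2 i)

lemma sq_add_sq_pos_of_snd_pos {u : ℕ × ℕ} (h : 0 < u.2) : 0 < (u.1 : ℝ) ^ 2 + (u.2 : ℝ) ^ 2 := by
  positivity

lemma nonneg_of_tangent {p q x y i : ℝ} (hi : 0 ≤ i) (hside : 0 ≤ q * a - p * b)
    (hdist : r ^ 2 * (p ^ 2 + q ^ 2) ≤ (q * a - p * b) ^ 2) (h : 0 ≤ discForm a b r x y i) :
    0 ≤ q * x - p * y := by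
  have hdisc : (x - i * a) ^ 2 + (y - i * b) ^ 2 ≤ i ^ 2 * r ^ 2 := by
    unfold discForm at h; linarith
  have hsq : (q * (x - i * a) - p * (y - i * b)) ^ 2 ≤ (i * (q * a - p * b)) ^ 2 := by
    calc (q * (x - i * a) - p * (y - i * b)) ^ 2
        ≤ ((x - i * a) ^ 2 + (y - i * b) ^ 2) * (p ^ 2 + q ^ 2) := by
          nlinarith [sq_nonneg (p * (x - i * a) + q * (y - i * b))]
      _ ≤ i ^ 2 * r ^ 2 * (p ^ 2 + q ^ 2) := by gcongr
      _ = i ^ 2 * (r ^ 2 * (p ^ 2 + q ^ 2)) := by ring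
      _ ≤ i ^ 2 * (q * a - p * b) ^ 2 := by gcongr
      _ = (i * (q * a - p * b)) ^ 2 := by ring
  have := (abs_le.1 (abs_le_of_sq_le_sq hsq (by positivity))).1
  linarith

lemma height_eq_of_tangent {p q i s j : ℝ} (hpq : 0 < p ^ 2 + q ^ 2)
    (hdist : r ^ 2 * (p ^ 2 + q ^ 2) ≤ (q * a - p * b) ^ 2) (h : 0 ≤ discForm a b r p q i)
    (h' : 0 ≤ discForm a b r (s * p) (s * q) j) : j = s * i := by
  have foot_eq : ∀ s j : ℝ, 0 ≤ discForm a b r (s * p) (s * q) j →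
      s * (p ^ 2 + q ^ 2) = j * (a * p + b * q) := by
    intro s j h
    have hscaled : j ^ 2 * (r ^ 2 * (p ^ 2 + q ^ 2)) ≤ j ^ 2 * (q * a - p * b) ^ 2 := by gcongr
    have hsplit : (p ^ 2 + q ^ 2) * discForm a b r (s * p) (s * q) j =
        j ^ 2 * (r ^ 2 * (p ^ 2 + q ^ 2)) - j ^ 2 * (q * a - p * b) ^ 2 -
          (s * (p ^ 2 + q ^ 2) - j * (a * p + b * q)) ^ 2 := by unfold discForm; ring
    have : 0 ≤ (p ^ 2 + q ^ 2) * discForm a b r (s * p) (s * q) j := by positivity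
    nlinarith
  have hi := foot_eq 1 i (by simpa using h)
  have hj := foot_eq s j h'
  have hfoot : a * p + b * q ≠ 0 := by
    intro h0
    rw [h0] at hi
    linarith
  apply mul_right_cancel₀ hfoot
  linear_combination s * hi - hj

lemma IsLeftEdge.height_pos {u : ℕ × ℕ} {i N : ℕ} (h : IsLeftEdge a b r u i N) :
    (0 : ℝ) < i :=
  height_pos_of_discForm_nonneg h.mem (Nat.cast_nonneg _) (sq_add_sq_pos_of_snd_pos h.snd_pos)

lemma IsLeftEdge.mono {u : ℕ × ℕ} {i N N' : ℕ} (h : IsLeftEdge a b r u i N) (hN : N ≤ N') :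
    IsLeftEdge a b r u i N' where
  mem := h.mem
  snd_pos := h.snd_pos
  tangent_or_interior := h.tangent_or_interior.imp_right <| And.imp_right fun hN' =>
    hN'.trans (mul_le_mul_of_nonneg_right (by exact_mod_cast hN) h.mem)

lemma IsLeftEdge.nonneg {u : ℕ × ℕ} {i N : ℕ} (h : IsLeftEdge a b r u i N) {x y j : ℝ}
    (hx : 0 ≤ x) (hj : 0 ≤ j) (hxy : 0 ≤ discForm a b r x y j) : 0 ≤ u.2 * x - u.1 * y := by
  rcases h.tangent_or_interior with ⟨hside, hdist⟩ | ⟨h0, -⟩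
  · exact nonneg_of_tangent hj hside hdist hxy
  · rw [h0, Nat.cast_zero, zero_mul, sub_zero]
    positivity

lemma IsLeftEdge.exists_sub_on_ray {u : ℕ × ℕ} {i N : ℕ} (h : IsLeftEdge a b r u i N) {s : ℝ}
    (hs : 0 ≤ s) (hN : N ≤ s ^ 2) {j : ℕ}
    (hj : 0 ≤ discForm a b r ((s + 1) * u.1) ((s + 1) * u.2) j) :
    ∃ k : ℕ, 0 ≤ discForm a b r (s * u.1) (s * u.2) k := by
  rcases h.tangent_or_interior with ⟨-, hdist⟩ | ⟨-, hinterior⟩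
  · have hj' : (j : ℝ) = (s + 1) * i :=
      height_eq_of_tangent (sq_add_sq_pos_of_snd_pos h.snd_pos) hdist h.mem hj
    have hij : i ≤ j := by
      have : (i : ℝ) ≤ j := by rw [hj']; nlinarith [h.height_pos]
      exact_mod_cast this
    refine ⟨j - i, ?_⟩
    rw [Nat.cast_sub hij, show (j : ℝ) - i = s * i by rw [hj']; ring, discForm_smul]
    exact mul_nonneg (sq_nonneg s) h.mem
  · refine exists_nat_discForm_nonneg (t := s * i) (mul_nonneg hs h.height_pos.le) ?_
    rw [discForm_smul]
    exact hinterior.trans (mul_le_mul_of_nonneg_right hN h.mem)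

end Edges

section Frames

variable {a b r : ℝ}

/-- The determinant that is positive if and only if `u` has greater slope than `v`. -/
def slopeDet (u v : ℕ × ℕ) : ℤ := u.2 * v.1 - u.1 * v.2

lemma slopeDet_swap (u v : ℕ × ℕ) : slopeDet v.swap u.swap = slopeDet u v := by
  simp only [slopeDet, Prod.fst_swap, Prod.snd_swap]; ring

lemma slopeDet_add_left (u v w : ℕ × ℕ) : slopeDet (u + v) w = slopeDet u w + slopeDet v w := by
  simp only [slopeDet, Prod.fst_add, Prod.snd_add, Nat.cast_add]; ring

lemma slopeDet_add_right (u v w : ℕ × ℕ) : slopeDet u (v + w) = slopeDet u v + slopeDet u w := by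
  simp only [slopeDet, Prod.fst_add, Prod.snd_add, Nat.cast_add]; ring

lemma slopeDet_self (u : ℕ × ℕ) : slopeDet u u = 0 := by
  simp only [slopeDet]; ring

/-- Cramer's rule. -/
lemma slopeDet_mul_fst (u v n : ℕ × ℕ) :
    slopeDet u v * n.1 = slopeDet n v * u.1 + slopeDet u n * v.1 := by
  simp only [slopeDet]; ring

lemma slopeDet_mul_snd (u v n : ℕ × ℕ) :
    slopeDet u v * n.2 = slopeDet n v * u.2 + slopeDet u n * v.2 := by
  simp only [slopeDet]; ring

lemma slopeDet_le_mul (u v : ℕ × ℕ) : slopeDet u v ≤ (u.2 * v.1 : ℕ) := by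
  simp only [slopeDet, Nat.cast_mul, sub_le_self_iff]; positivity

/-- Two vectors of the semigroup, `u` at height `i` and `v` at height `j`, bounding it on both
sides. The constant `N` bounds the loss caused by rounding heights between the two rays. -/
structure IsFrame (a b r : ℝ) (u : ℕ × ℕ) (i : ℕ) (v : ℕ × ℕ) (j N : ℕ) : Prop where
  left : IsLeftEdge a b r u i N
  right : IsLeftEdge b a r v.swap j N
  slopeDet_pos : 0 < slopeDet u v
  polar : |a ^ 2 + b ^ 2 - r ^ 2| ≤ N * (2 * discPolar a b r u.1 u.2 i v.1 v.2 j)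

/-- The size of a box that contains all irreducible elements of the semigroup. -/
def frameBound (u v : ℕ × ℕ) (N : ℕ) : ℕ :=
  u.2 * v.1 * (N * (u.2 * v.1) + 1) * (u.1 + u.2 + v.1 + v.2)

lemma frameBound_swap (u v : ℕ × ℕ) (N : ℕ) : frameBound v.swap u.swap N = frameBound u v N := by
  simp only [frameBound, Prod.fst_swap, Prod.snd_swap]; ring

variable {u v n : ℕ × ℕ} {i j N : ℕ}

lemma IsFrame.swap (h : IsFrame a b r u i v j N) : IsFrame b a r v.swap j u.swap i N where
  left := h.right
  right := h.left
  slopeDet_pos := by rw [slopeDet_swap]; exact h.slopeDet_pos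
  polar := by
    have := h.polar
    rwa [← discPolar_swap, discPolar_comm, add_comm (a ^ 2)] at this

lemma IsFrame.mem_right (h : IsFrame a b r u i v j N) : 0 ≤ discForm a b r v.1 v.2 j := by
  rw [← discForm_swap]
  exact h.right.mem

lemma IsFrame.discPolar_pos (h : IsFrame a b r u i v j N) :
    0 < discPolar a b r u.1 u.2 i v.1 v.2 j := by
  refine _root_.discPolar_pos h.left.height_pos h.right.height_pos h.left.mem h.mem_right ?_
  have := h.slopeDet_pos
  rw [slopeDet, sub_pos] at this
  exact_mod_cast this.ne

lemma IsFrame.slopeDet_left_nonneg (h : IsFrame a b r u i v j N)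
    (hn : ∃ k : ℕ, 0 ≤ discForm a b r n.1 n.2 k) : 0 ≤ slopeDet u n := by
  obtain ⟨k, hk⟩ := hn
  have := h.left.nonneg (Nat.cast_nonneg n.1) (Nat.cast_nonneg k) hk
  rw [slopeDet]
  exact_mod_cast this

lemma IsFrame.exists_discForm_nonneg_of_le_mul (h : IsFrame a b r u i v j N) {x y s t : ℝ}
    (hs : 0 ≤ s) (ht : 0 ≤ t) (hN : N ≤ s * t) (hx : x = s * u.1 + t * v.1)
    (hy : y = s * u.2 + t * v.2) : ∃ k : ℕ, 0 ≤ discForm a b r x y k := by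
  have hpolar := h.discPolar_pos.le
  have hu := h.left.mem
  have hv := h.mem_right
  refine exists_nat_discForm_nonneg (t := s * i + t * j) (by positivity) ?_
  rw [hx, hy, discForm_comb]
  have hst : N * (2 * discPolar a b r u.1 u.2 i v.1 v.2 j) ≤
      s * t * (2 * discPolar a b r u.1 u.2 i v.1 v.2 j) := by gcongr
  have hu' : 0 ≤ s ^ 2 * discForm a b r u.1 u.2 i := by positivity
  have hv' : 0 ≤ t ^ 2 * discForm a b r v.1 v.2 j := by positivity
  linarith [h.polar]

lemma eq_div_slopeDet_mul_add (h : 0 < slopeDet u v) (n : ℕ × ℕ) :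
    (n.1 : ℝ) = (slopeDet n v / slopeDet u v : ℝ) * u.1 + (slopeDet u n / slopeDet u v : ℝ) * v.1 ∧
      (n.2 : ℝ) =
        (slopeDet n v / slopeDet u v : ℝ) * u.2 + (slopeDet u n / slopeDet u v : ℝ) * v.2 := by
  have : (0 : ℝ) < slopeDet u v := by exact_mod_cast h
  constructor <;> field_simp <;> rw [mul_comm]
  · exact_mod_cast slopeDet_mul_fst u v n
  · exact_mod_cast slopeDet_mul_snd u v n

lemma IsFrame.exists_discForm_nonneg_of_le_slopeDet_mul (h : IsFrame a b r u i v j N)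
    (hl : 0 ≤ slopeDet u n) (hr : 0 ≤ slopeDet n v)
    (hN : N * slopeDet u v ^ 2 ≤ slopeDet n v * slopeDet u n) :
    ∃ k : ℕ, 0 ≤ discForm a b r n.1 n.2 k := by
  have : (0 : ℝ) < slopeDet u v := by exact_mod_cast h.slopeDet_pos
  have : (0 : ℝ) ≤ slopeDet u n := by exact_mod_cast hl
  have : (0 : ℝ) ≤ slopeDet n v := by exact_mod_cast hr
  obtain ⟨h1, h2⟩ := eq_div_slopeDet_mul_add h.slopeDet_pos n
  refine h.exists_discForm_nonneg_of_le_mul (by positivity) (by positivity) ?_ h1 h2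
  rw [div_mul_div_comm, le_div_iff₀ (by positivity), ← sq]
  exact_mod_cast hN

lemma IsFrame.exists_discForm_nonneg_on_left (h : IsFrame a b r u i v j N) (hl : slopeDet u n = 0)
    (hr : N * slopeDet u v ^ 2 ≤ slopeDet n v) {k : ℕ}
    (hk : 0 ≤ discForm a b r (n + u).1 (n + u).2 k) :
    ∃ l : ℕ, 0 ≤ discForm a b r n.1 n.2 l := by
  have hD := h.slopeDet_pos
  have : (0 : ℝ) < slopeDet u v := by exact_mod_cast hD
  have hr0 : 0 ≤ slopeDet n v := le_trans (by positivity) hr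
  have : (0 : ℝ) ≤ slopeDet n v := by exact_mod_cast hr0
  obtain ⟨h1, h2⟩ := eq_div_slopeDet_mul_add hD n
  simp only [hl, Int.cast_zero, zero_div, zero_mul, add_zero] at h1 h2
  rw [h1, h2]
  refine h.left.exists_sub_on_ray (j := k) (by positivity) ?_ ?_
  · rw [div_pow, le_div_iff₀ (by positivity)]
    have : N * slopeDet u v ^ 2 ≤ slopeDet n v ^ 2 := hr.trans (Int.le_self_sq _)
    exact_mod_cast this
  · rwa [add_one_mul, add_one_mul, ← h1, ← h2, ← Nat.cast_add, ← Nat.cast_add]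

lemma le_of_slopeDet_le_slopeDet (huv : 0 < slopeDet u v) (hl : 0 ≤ slopeDet u n)
    (hr : slopeDet u v ≤ slopeDet n v) : u ≤ n := by
  have : (0 : ℤ) ≤ u.1 := by positivity
  have : (0 : ℤ) ≤ u.2 := by positivity
  have : (0 : ℤ) ≤ v.1 := by positivity
  have : (0 : ℤ) ≤ v.2 := by positivity
  have h1 := slopeDet_mul_fst u v n
  have h2 := slopeDet_mul_snd u v n
  constructor
  · have : (u.1 : ℤ) ≤ n.1 := by nlinarith
    exact_mod_cast this
  · have : (u.2 : ℤ) ≤ n.2 := by nlinarith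
    exact_mod_cast this

lemma IsFrame.exists_sub_left (h : IsFrame a b r u i v j N) {k : ℕ}
    (hk : 0 ≤ discForm a b r n.1 n.2 k)
    (hfar : N * slopeDet u v ^ 2 + slopeDet u v ≤ slopeDet n v) :
    ∃ m : ℕ × ℕ, (∃ l : ℕ, 0 ≤ discForm a b r m.1 m.2 l) ∧ n = m + u := by
  have hD := h.slopeDet_pos
  have hl := h.slopeDet_left_nonneg ⟨k, hk⟩
  have hN : 0 ≤ N * slopeDet u v ^ 2 := by positivity
  obtain ⟨m, rfl⟩ := exists_add_of_le (le_of_slopeDet_le_slopeDet hD hl (by linarith))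
  rw [add_comm u m] at hk hfar hl ⊢
  rw [slopeDet_add_left] at hfar
  rw [slopeDet_add_right, slopeDet_self, add_zero] at hl
  refine ⟨m, ?_, rfl⟩
  have hm : N * slopeDet u v ^ 2 ≤ slopeDet m v := by linarith
  rcases hl.eq_or_lt with hray | hinside
  · exact h.exists_discForm_nonneg_on_left hray.symm hm hk
  · exact h.exists_discForm_nonneg_of_le_slopeDet_mul hl (hN.trans hm)
      (hm.trans (le_mul_of_one_le_right (hN.trans hm) hinside))

lemma IsFrame.exists_sub_right (h : IsFrame a b r u i v j N) {k : ℕ}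
    (hk : 0 ≤ discForm a b r n.1 n.2 k)
    (hfar : N * slopeDet u v ^ 2 + slopeDet u v ≤ slopeDet u n) :
    ∃ m : ℕ × ℕ, (∃ l : ℕ, 0 ≤ discForm a b r m.1 m.2 l) ∧ n = m + v := by
  obtain ⟨m, hm, hnm⟩ := h.swap.exists_sub_left (n := n.swap) (by rwa [← discForm_swap] at hk)
    (by rwa [slopeDet_swap, slopeDet_swap])
  refine ⟨m.swap, ?_, Prod.swap_injective hnm⟩
  simpa only [Prod.fst_swap, Prod.snd_swap, discForm_swap] using hm

lemma le_frameBound_of_slopeDet_le (huv : 0 < slopeDet u v)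
    (hr : slopeDet n v ≤ N * slopeDet u v ^ 2 + slopeDet u v)
    (hl : slopeDet u n ≤ N * slopeDet u v ^ 2 + slopeDet u v) :
    n ≤ (frameBound u v N, frameBound u v N) := by
  set d : ℤ := ((u.2 * v.1 : ℕ) : ℤ) with hd
  set B : ℤ := d * (N * d + 1) with hB
  have hBound : ((frameBound u v N : ℕ) : ℤ) = B * (u.1 + u.2 + v.1 + v.2) := by
    rw [hB, hd, frameBound]; push_cast; ring
  have hd0 := slopeDet_le_mul u v
  rw [← hd] at hd0
  have hle : N * slopeDet u v ^ 2 + slopeDet u v ≤ B := by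
    calc N * slopeDet u v ^ 2 + slopeDet u v ≤ N * d ^ 2 + d := by gcongr
      _ = B := by ring
  have : 0 ≤ B := by positivity
  have key : ∀ c p q : ℕ, slopeDet u v * c = slopeDet n v * p + slopeDet u n * q →
      p + q ≤ u.1 + u.2 + v.1 + v.2 → c ≤ frameBound u v N := by
    intro c p q hc hpq
    zify at hpq ⊢
    rw [hBound]
    calc (c : ℤ) ≤ slopeDet u v * c := le_mul_of_one_le_left (by positivity) huv
      _ = slopeDet n v * p + slopeDet u n * q := hc
      _ ≤ B * p + B * q := by gcongr <;> linarith
      _ = B * (p + q) := by ring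
      _ ≤ B * (u.1 + u.2 + v.1 + v.2) := by gcongr
  exact ⟨key _ _ _ (slopeDet_mul_fst u v n) (by omega),
    key _ _ _ (slopeDet_mul_snd u v n) (by omega)⟩

lemma IsFrame.exists_sub (h : IsFrame a b r u i v j N)
    (hn : ∃ k : ℕ, 0 ≤ discForm a b r n.1 n.2 k)
    (hfar : ¬ n ≤ (frameBound u v N, frameBound u v N)) :
    ∃ m : ℕ × ℕ, (∃ l : ℕ, 0 ≤ discForm a b r m.1 m.2 l) ∧ (n = m + u ∨ n = m + v) := by
  obtain ⟨k, hk⟩ := hn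
  by_cases hr : slopeDet n v ≤ N * slopeDet u v ^ 2 + slopeDet u v
  · have hl : N * slopeDet u v ^ 2 + slopeDet u v ≤ slopeDet u n := by
      by_contra! hl
      exact hfar (le_frameBound_of_slopeDet_le h.slopeDet_pos hr hl.le)
    obtain ⟨m, hm, hnm⟩ := h.exists_sub_right hk hl
    exact ⟨m, hm, Or.inr hnm⟩
  · obtain ⟨m, hm, hnm⟩ := h.exists_sub_left hk (not_le.1 hr).le
    exact ⟨m, hm, Or.inl hnm⟩

lemma IsFrame.left_le_frameBound (h : IsFrame a b r u i v j N) :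
    u ≤ (frameBound u v N, frameBound u v N) :=
  le_frameBound_of_slopeDet_le h.slopeDet_pos (by nlinarith [sq_nonneg (slopeDet u v)])
    (by rw [slopeDet_self]; have := h.slopeDet_pos; positivity)

lemma IsFrame.right_le_frameBound (h : IsFrame a b r u i v j N) :
    v ≤ (frameBound u v N, frameBound u v N) := by
  have := h.swap.left_le_frameBound
  rw [frameBound_swap] at this
  exact ⟨this.2, this.1⟩

lemma IsFrame.closure_inter_Iic (h : IsFrame a b r u i v j N) (hr : 0 < r) :
    AddSubmonoid.closure (discSemigroup a b r hr ∩ Set.Iic (frameBound u v N, frameBound u v N)) =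
      discSemigroup a b r hr := by
  refine closure_eq_of_forall_exists_add Set.inter_subset_left fun n hn hnB => ?_
  have hfar : ¬ n ≤ (frameBound u v N, frameBound u v N) := fun hle => hnB ⟨hn, hle⟩
  have hu0 : u ≠ 0 := by rintro rfl; exact h.left.snd_pos.ne rfl
  have hv0 : v ≠ 0 := by rintro rfl; exact h.right.snd_pos.ne rfl
  obtain ⟨m, hm, hnm⟩ := h.exists_sub (mem_discSemigroup_iff.1 hn) hfar
  refine ⟨m, mem_discSemigroup_iff.2 hm, ?_⟩
  rcases hnm with rfl | rfl
  · refine ⟨u, mem_discSemigroup_iff.2 ⟨i, h.left.mem⟩, ?_, hu0, rfl⟩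
    rintro rfl
    exact hfar (by rw [zero_add]; exact h.left_le_frameBound)
  · refine ⟨v, mem_discSemigroup_iff.2 ⟨j, h.mem_right⟩, ?_, hv0, rfl⟩
    rintro rfl
    exact hfar (by rw [zero_add]; exact h.right_le_frameBound)

lemma IsFrame.fg (h : IsFrame a b r u i v j N) (hr : 0 < r) : (discSemigroup a b r hr).FG :=
  (AddSubmonoid.fg_iff _).2
    ⟨_, h.closure_inter_Iic hr, (Set.finite_Iic _).inter_of_right _⟩

lemma IsFrame.le_frameBound_of_mem_irreducibles (h : IsFrame a b r u i v j N) {hr : 0 < r}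
    (hn : n ∈ irreducibles (discSemigroup a b r hr)) :
    n ≤ (frameBound u v N, frameBound u v N) :=
  (irreducibles_subset_of_closure_eq (h.closure_inter_Iic hr) hn).2

lemma IsFrame.le_frameBound_of_not_mem (h : IsFrame a b r u i v j N) {hr : 0 < r}
    (hl : 0 < slopeDet u n) (hrt : 0 < slopeDet n v) (hn : n ∉ discSemigroup a b r hr) :
    n ≤ (frameBound u v N, frameBound u v N) := by
  have hlt : slopeDet n v * slopeDet u n < N * slopeDet u v ^ 2 := by
    by_contra! hN
    exact hn (mem_discSemigroup_iff.2 (h.exists_discForm_nonneg_of_le_slopeDet_mul hl.le hrt.le hN))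
  have := h.slopeDet_pos
  exact le_frameBound_of_slopeDet_le this (by nlinarith) (by nlinarith)

end Frames

section ExtremalRays

lemma nnrat_smul_eq_real_smul (q : ℚ≥0) (X : Plane) : q • X = (q : ℝ) • X := by
  ext j
  simp [NNRat.smul_def]

lemma convex_quadrant : Convex ℝ quadrant := by
  rintro X ⟨hX₀, hX₁⟩ Y ⟨hY₀, hY₁⟩ s t hs ht -
  constructor <;> simp only [PiLp.add_apply, PiLp.smul_apply, smul_eq_mul] <;> positivity

/-- An extremal ray contains a generator, since otherwise it would contain no non-zero combination
of generators. -/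
lemma IsExtremalRay.exists_mem {A : Set Plane} {τ : Submodule ℝ Plane}
    (h : IsExtremalRay (rationalCone A) τ) : ∃ P ∈ A, P ∈ τ ∧ P ≠ 0 := by
  obtain ⟨-, ⟨X, hX, hXτ, hX0⟩, hext⟩ := h
  by_contra! hcon
  refine hX0 (Submodule.span_induction (p := fun X _ => X ∈ τ → X = 0) hcon (fun _ => rfl) ?_ ?_
    hX hXτ)
  · intro X Y hX hY ihX ihY hXY
    obtain ⟨hXτ, hYτ⟩ := hext X hX Y hY hXY
    rw [ihX hXτ, ihY hYτ, add_zero]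
  · intro q X _ ihX hqX
    rcases eq_or_ne q 0 with rfl | hq
    · exact zero_smul _ X
    · have hq' : (q : ℝ) ≠ 0 := by exact_mod_cast hq
      rw [nnrat_smul_eq_real_smul] at hqX
      rw [ihX ((τ.smul_mem_iff hq').1 hqX), smul_zero]

variable {τ : Submodule ℝ Plane} {P X : Plane}

lemma exists_smul_eq_of_mem_line (h : Module.finrank ℝ τ = 1) (hP : P ∈ τ) (hP0 : P ≠ 0)
    (hX : X ∈ τ) : ∃ c : ℝ, X = c • P := by
  obtain ⟨c, hc⟩ :=
    (finrank_eq_one_iff_of_nonzero' (⟨P, hP⟩ : τ) (by simpa using hP0)).1 h ⟨X, hX⟩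
  exact ⟨c, (congrArg Subtype.val hc).symm⟩

lemma mem_iff_of_finrank_eq_one (h : Module.finrank ℝ τ = 1) (hP : P ∈ τ) (hP0 : P ≠ 0) :
    X ∈ τ ↔ P 1 * X 0 = P 0 * X 1 := by
  constructor
  · intro hX
    obtain ⟨c, rfl⟩ := exists_smul_eq_of_mem_line h hP hP0 hX
    simp only [PiLp.smul_apply, smul_eq_mul]
    ring
  · intro hX
    have hnorm : P 0 ^ 2 + P 1 ^ 2 ≠ 0 := by
      intro h0
      refine hP0 (PiLp.ext (Fin.forall_fin_two.2 ⟨?_, ?_⟩)) <;> simp only [PiLp.zero_apply] <;>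
        nlinarith
    have hproj : X = ((P 0 * X 0 + P 1 * X 1) / (P 0 ^ 2 + P 1 ^ 2)) • P := by
      refine PiLp.ext (Fin.forall_fin_two.2 ⟨?_, ?_⟩) <;>
        simp only [PiLp.smul_apply, smul_eq_mul] <;> field_simp
      · linear_combination P 1 * hX
      · linear_combination -P 0 * hX
    rw [hproj]
    exact τ.smul_mem _ hP

lemma exists_nonneg_smul_eq_of_mem_line (h : Module.finrank ℝ τ = 1) (hP : P ∈ τ)
    (hP0 : P ≠ 0) (hPQ : P ∈ quadrant) (hX : X ∈ τ) (hXQ : X ∈ quadrant) :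
    ∃ c : ℝ, 0 ≤ c ∧ X = c • P := by
  obtain ⟨c, rfl⟩ := exists_smul_eq_of_mem_line h hP hP0 hX
  refine ⟨c, not_lt.1 fun hc => hP0 (PiLp.ext (Fin.forall_fin_two.2 ⟨?_, ?_⟩)), rfl⟩
  · exact le_antisymm (nonpos_of_mul_nonneg_right hXQ.1 hc) hPQ.1
  · exact le_antisymm (nonpos_of_mul_nonneg_right hXQ.2 hc) hPQ.2

lemma SlopeGreater.mul_lt_mul {τ₁ τ₂ : Submodule ℝ Plane} (h : SlopeGreater τ₁ τ₂)
    (h₁ : Module.finrank ℝ τ₁ = 1) (h₂ : Module.finrank ℝ τ₂ = 1) {P Q : Plane} (hP : P ∈ τ₁)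
    (hP0 : P ≠ 0) (hPQ : P ∈ quadrant) (hQ : Q ∈ τ₂) (hQ0 : Q ≠ 0) (hQQ : Q ∈ quadrant) :
    P 0 * Q 1 < P 1 * Q 0 := by
  obtain ⟨u, hu, v, hv, huQ, hvQ, huv⟩ := h
  obtain ⟨c, hc, rfl⟩ := exists_nonneg_smul_eq_of_mem_line h₁ hP hP0 hPQ hu huQ
  obtain ⟨d, hd, rfl⟩ := exists_nonneg_smul_eq_of_mem_line h₂ hQ hQ0 hQQ hv hvQ
  simp only [PiLp.smul_apply, smul_eq_mul] at huv
  refine lt_of_mul_lt_mul_left ?_ (mul_nonneg hc hd)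
  linarith

/-- If points of `A` lie strictly on both sides of `τ`, then by convexity two of them are at
opposite distances from `τ`, so that their sum lies on `τ`. -/
lemma IsExtremalRay.nonneg_of_pos {A : Set Plane} (hA : Convex ℝ A)
    (h : IsExtremalRay (rationalCone A) τ) (f : Plane →ₗ[ℝ] ℝ) (hf : ∀ X, X ∈ τ ↔ f X = 0)
    {Y : Plane} (hX : X ∈ A) (hY : Y ∈ A) (hfY : 0 < f Y) : 0 ≤ f X := by
  by_contra! hfX
  set e := min (-f X) (f Y)
  have he : 0 < e := lt_min (neg_pos.2 hfX) hfY
  have hImage : Set.Icc (f X) (f Y) ⊆ f '' A :=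
    (hA.linear_image f).ordConnected.out (Set.mem_image_of_mem f hX) (Set.mem_image_of_mem f hY)
  have heX : e ≤ -f X := min_le_left _ _
  have heY : e ≤ f Y := min_le_right _ _
  obtain ⟨U, hU, hfU⟩ := hImage (show -e ∈ _ from ⟨by linarith, by linarith⟩)
  obtain ⟨V, hV, hfV⟩ := hImage (show e ∈ _ from ⟨by linarith, heY⟩)
  have hUV := h.2.2 U (Submodule.subset_span hU) V (Submodule.subset_span hV)
    ((hf _).2 (by rw [map_add, hfU, hfV, neg_add_cancel]))
  exact he.ne' (hfV ▸ (hf V).1 hUV.2)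

end ExtremalRays

section RayPairs

/-- The points `P` and `Q` of the disc span the boundary rays of the part of the disc in the
quadrant, that of greater slope being spanned by `P`. -/
structure IsRayPair (a b r : ℝ) (P Q : ℝ × ℝ) : Prop where
  left_nonneg : 0 ≤ P
  right_nonneg : 0 ≤ Q
  left_mem : 0 ≤ discForm a b r P.1 P.2 1
  right_mem : 0 ≤ discForm a b r Q.1 Q.2 1
  slope_lt : P.1 * Q.2 < P.2 * Q.1
  le_left : ∀ z : ℝ × ℝ, 0 ≤ z → 0 ≤ discForm a b r z.1 z.2 1 → P.1 * z.2 ≤ P.2 * z.1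
  le_right : ∀ z : ℝ × ℝ, 0 ≤ z → 0 ≤ discForm a b r z.1 z.2 1 → Q.2 * z.1 ≤ Q.1 * z.2

variable {a b r : ℝ} {P Q : ℝ × ℝ}

lemma IsRayPair.swap (h : IsRayPair a b r P Q) : IsRayPair b a r Q.swap P.swap where
  left_nonneg := ⟨h.right_nonneg.2, h.right_nonneg.1⟩
  right_nonneg := ⟨h.left_nonneg.2, h.left_nonneg.1⟩
  left_mem := by rw [← discForm_swap] at *; exact h.right_mem
  right_mem := by rw [← discForm_swap] at *; exact h.left_mem
  slope_lt := by simpa only [Prod.fst_swap, Prod.snd_swap, mul_comm] using h.slope_lt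
  le_left z hz hmem := h.le_right z.swap ⟨hz.2, hz.1⟩ (by rwa [← discForm_swap] at hmem)
  le_right z hz hmem := h.le_left z.swap ⟨hz.2, hz.1⟩ (by rwa [← discForm_swap] at hmem)

lemma IsRayPair.left_snd_pos (h : IsRayPair a b r P Q) : 0 < P.2 := by
  refine h.left_nonneg.2.lt_of_ne fun h0 => h.slope_lt.not_ge ?_
  rw [← h0, Prod.snd_zero, zero_mul]
  exact mul_nonneg h.left_nonneg.1 h.right_nonneg.2

lemma IsRayPair.right_fst_pos (h : IsRayPair a b r P Q) : 0 < Q.1 := h.swap.left_snd_pos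

lemma AreExtremalRays.exists_isRayPair (hr : 0 < r) {τ₁ τ₂ : Submodule ℝ Plane}
    (h : AreExtremalRays a b r τ₁ τ₂) : ∃ P Q : ℝ × ℝ, IsRayPair a b r P Q ∧
      (∀ X : Plane, X ∈ τ₁ ↔ P.2 * X 0 = P.1 * X 1) ∧
      (∀ X : Plane, X ∈ τ₂ ↔ Q.2 * X 0 = Q.1 * X 1) := by
  obtain ⟨h₁, h₂, hslope⟩ := h
  obtain ⟨P, hPA, hPτ, hP0⟩ := h₁.exists_mem
  obtain ⟨Q, hQA, hQτ, hQ0⟩ := h₂.exists_mem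
  have hτ₁ : ∀ X, X ∈ τ₁ ↔ _ := fun X => mem_iff_of_finrank_eq_one h₁.1 hPτ hP0 (X := X)
  have hτ₂ : ∀ X, X ∈ τ₂ ↔ _ := fun X => mem_iff_of_finrank_eq_one h₂.1 hQτ hQ0 (X := X)
  have hA : Convex ℝ (disc a b r ∩ quadrant) := (convex_closedBall _ _).inter convex_quadrant
  have hdet := hslope.mul_lt_mul h₁.1 h₂.1 hPτ hP0 hPA.2 hQτ hQ0 hQA.2
  have mem_of_nonneg : ∀ z : ℝ × ℝ, 0 ≤ z → 0 ≤ discForm a b r z.1 z.2 1 →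
      (!₂[z.1, z.2] : Plane) ∈ disc a b r ∩ quadrant := fun z hz hmem =>
    ⟨(mem_disc_iff hr.le).2 (by simpa using hmem), by simpa using hz.1, by simpa using hz.2⟩
  let coord : Fin 2 → Plane →ₗ[ℝ] ℝ := fun i => (EuclideanSpace.proj (𝕜 := ℝ) i).toLinearMap
  refine ⟨(P 0, P 1), (Q 0, Q 1), ⟨hPA.2, hQA.2, (mem_disc_iff hr.le).1 hPA.1,
    (mem_disc_iff hr.le).1 hQA.1, hdet, fun z hz hmem => ?_, fun z hz hmem => ?_⟩, hτ₁, hτ₂⟩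
  · have := h₁.nonneg_of_pos hA (P 1 • coord 0 - P 0 • coord 1)
      (fun X => by simp [hτ₁, coord, sub_eq_zero]) (mem_of_nonneg z hz hmem) hQA
      (by simpa [coord] using hdet)
    simpa [coord] using this
  · have := h₂.nonneg_of_pos hA (Q 0 • coord 1 - Q 1 • coord 0)
      (fun X => by rw [hτ₂, eq_comm]; simp [coord, sub_eq_zero]) (mem_of_nonneg z hz hmem) hPA
      (by simpa [coord, mul_comm] using hdet)
    simpa [coord] using this

lemma IsRayPair.nonneg_of_mem_rationalCone (hr : 0 < r) (h : IsRayPair a b r P Q) {X : Plane}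
    (hX : X ∈ rationalCone (disc a b r ∩ quadrant)) :
    0 ≤ P.2 * X 0 - P.1 * X 1 ∧ 0 ≤ Q.1 * X 1 - Q.2 * X 0 := by
  refine Submodule.span_induction
    (p := fun X _ => 0 ≤ P.2 * X 0 - P.1 * X 1 ∧ 0 ≤ Q.1 * X 1 - Q.2 * X 0) ?_ (by simp) ?_ ?_ hX
  · intro X hX
    have hmem := (mem_disc_iff hr.le).1 hX.1
    exact ⟨sub_nonneg.2 (h.le_left (X 0, X 1) hX.2 hmem),
      sub_nonneg.2 (h.le_right (X 0, X 1) hX.2 hmem)⟩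
  · rintro X Y - - ⟨hX₁, hX₂⟩ ⟨hY₁, hY₂⟩
    simp only [PiLp.add_apply]
    constructor <;> linarith
  · rintro q X - ⟨h₁, h₂⟩
    have hq : (0 : ℝ) ≤ q := by positivity
    simp only [nnrat_smul_eq_real_smul, PiLp.smul_apply, smul_eq_mul]
    constructor <;> nlinarith

lemma IsRayPair.nonneg_of_mem_integerCone (hr : 0 < r) (h : IsRayPair a b r P Q) {n : ℕ × ℕ}
    (hn : n ∈ integerCone a b r) :
    0 ≤ P.2 * n.1 - P.1 * n.2 ∧ 0 ≤ Q.1 * n.2 - Q.2 * n.1 := by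
  simpa [latticePoint] using h.nonneg_of_mem_rationalCone hr hn

end RayPairs

section RationalPoints

variable {a b r : ℝ} {P Q : ℝ × ℝ}

lemma exists_nat_mul_rat_eq {p q : ℚ} (hp : 0 ≤ p) (hq : 0 ≤ q) :
    ∃ u : ℕ × ℕ, ∃ i : ℕ, 0 < i ∧ (u.1 : ℝ) = i * p ∧ (u.2 : ℝ) = i * q := by
  lift p to ℚ≥0 using hp
  lift q to ℚ≥0 using hq
  refine ⟨(p.num * q.den, q.num * p.den), p.den * q.den, Nat.mul_pos p.den_pos q.den_pos, ?_, ?_⟩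
  · have := NNRat.mul_den_eq_num p
    norm_cast
    rw [Nat.cast_mul, Nat.cast_mul, ← this]
    ring
  · have := NNRat.mul_den_eq_num q
    norm_cast
    rw [Nat.cast_mul, Nat.cast_mul, ← this]
    ring

/-- The point of the disc in direction `(-q, p)` from the center is the one that is closest to
violating the assumption. -/
lemma tangent_of_forall_le {p q : ℝ} (hr : 0 ≤ r) (hpq : 0 < p ^ 2 + q ^ 2)
    (h : ∀ z : ℝ × ℝ, 0 ≤ discForm a b r z.1 z.2 1 → p * z.2 ≤ q * z.1) :
    0 ≤ q * a - p * b ∧ r ^ 2 * (p ^ 2 + q ^ 2) ≤ (q * a - p * b) ^ 2 := by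
  set s := √(p ^ 2 + q ^ 2)
  have hs0 : 0 < s := Real.sqrt_pos.2 hpq
  have hs2 : s ^ 2 = p ^ 2 + q ^ 2 := Real.sq_sqrt hpq.le
  have hmem : discForm a b r (a - r * q / s) (b + r * p / s) 1 = 0 := by
    have : discForm a b r (a - r * q / s) (b + r * p / s) 1 =
        r ^ 2 - r ^ 2 * ((p ^ 2 + q ^ 2) / s ^ 2) := by
      unfold discForm; field_simp; ring
    rw [this, hs2, div_self hpq.ne', mul_one, sub_self]
  have hfar := h (a - r * q / s, b + r * p / s) hmem.ge
  have hrs : r * s ≤ q * a - p * b := by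
    have : r * s = p * (r * p / s) + q * (r * q / s) := by
      field_simp
      linear_combination r * hs2
    linarith
  refine ⟨(mul_nonneg hr hs0.le).trans hrs, ?_⟩
  rw [← hs2, ← mul_pow]
  gcongr

/-- Moving from `P` towards a point of the disc beyond the left ray stays in the quadrant for a
while, unless `P` lies on the vertical axis. -/
lemma IsRayPair.left_fst_eq_zero (h : IsRayPair a b r P Q) {z : ℝ × ℝ}
    (hmem : 0 ≤ discForm a b r z.1 z.2 1) (hz : P.2 * z.1 < P.1 * z.2) : P.1 = 0 := by
  by_contra hP₁
  have hP₁ : 0 < P.1 := h.left_nonneg.1.lt_of_ne' hP₁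
  have hnear : ∀ᶠ t : ℝ in 𝓝 0, 0 < (1 - t) * P.1 + t * z.1 ∧ 0 < (1 - t) * P.2 + t * z.2 ∧
      t < 1 := by
    have hc : ∀ p q : ℝ, 0 < p → ∀ᶠ t : ℝ in 𝓝 0, 0 < (1 - t) * p + t * q := fun p q hp =>
      (Continuous.tendsto' (by fun_prop) 0 p (by simp)).eventually_const_lt hp
    exact (hc _ _ hP₁).and ((hc _ _ h.left_snd_pos).and (eventually_lt_nhds one_pos))
  obtain ⟨t, ⟨h₁, h₂, ht1⟩, ht⟩ :=
    ((hnear.filter_mono nhdsWithin_le_nhds).and (self_mem_nhdsWithin (s := Set.Ioi 0))).exists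
  have : 0 < t := ht
  have := h.le_left ((1 - t) * P.1 + t * z.1, (1 - t) * P.2 + t * z.2) ⟨h₁.le, h₂.le⟩ (by
    rw [discForm_convexComb]
    have := h.left_mem
    have : 0 ≤ 1 - t := by linarith
    positivity)
  nlinarith

lemma IsRayPair.exists_isLeftEdge_of_tangent (hr : 0 ≤ r) (h : IsRayPair a b r P Q) {p q : ℚ}
    (hmem : 0 ≤ discForm a b r p q 1) (hpq : P.2 * p = P.1 * q)
    (hside : ∀ z : ℝ × ℝ, 0 ≤ discForm a b r z.1 z.2 1 → P.1 * z.2 ≤ P.2 * z.1) :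
    ∃ u : ℕ × ℕ, ∃ i N : ℕ, IsLeftEdge a b r u i N ∧
      ∃ s : ℝ, 0 < s ∧ (u.1 : ℝ) = s * P.1 ∧ (u.2 : ℝ) = s * P.2 := by
  have hP₂ := h.left_snd_pos
  have hP : 0 < P.1 ^ 2 + P.2 ^ 2 := by positivity
  obtain ⟨hcenter, hdist⟩ := tangent_of_forall_le hr hP hside
  have hp : (p : ℝ) = q / P.2 * P.1 := by field_simp; linarith
  have hq : (q : ℝ) = q / P.2 * P.2 := by field_simp
  have hscale : (1 : ℝ) = q / P.2 * 1 :=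
    height_eq_of_tangent hP hdist h.left_mem (by rwa [← hp, ← hq])
  rw [← mul_one (q / P.2 : ℝ), ← hscale, one_mul] at hp hq
  obtain ⟨u, i, hi, hu₁, hu₂⟩ := exists_nat_mul_rat_eq (p := p) (q := q)
    (by have : (0 : ℝ) ≤ p := hp ▸ h.left_nonneg.1
        exact_mod_cast this)
    (by have : (0 : ℝ) ≤ q := hq ▸ hP₂.le
        exact_mod_cast this)
  rw [hp] at hu₁
  rw [hq] at hu₂
  have hi : (0 : ℝ) < i := by exact_mod_cast hi
  refine ⟨u, i, 0, ⟨?_, ?_, Or.inl ⟨?_, ?_⟩⟩, i, hi, hu₁, hu₂⟩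
  · rw [hu₁, hu₂, discForm_smul_one_nonneg_iff hi]
    exact h.left_mem
  · have : (0 : ℝ) < u.2 := by rw [hu₂]; positivity
    exact_mod_cast this
  · rw [hu₁, hu₂, mul_assoc, mul_assoc, ← mul_sub]
    positivity
  · rw [hu₁, hu₂, mul_assoc, mul_assoc, ← mul_sub, mul_pow, mul_pow, mul_pow, ← mul_add,
      mul_left_comm]
    gcongr

lemma IsRayPair.exists_discForm_axis_pos (hr : 0 ≤ r) (h : IsRayPair a b r P Q) (hP : P.1 = 0)
    {z : ℝ × ℝ} (hmem : 0 ≤ discForm a b r z.1 z.2 1) (hz : z.1 < 0) :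
    ∃ y : ℝ, 0 < y ∧ 0 < discForm a b r 0 y 1 := by
  have hPmem := h.left_mem
  have hQmem := h.right_mem
  have hP₂ := h.left_snd_pos
  simp only [discForm, hP, one_pow, one_mul] at *
  have har := abs_le_of_sq_le_sq' (show (z.1 - a) ^ 2 ≤ r ^ 2 by nlinarith) hr
  have har' := abs_le_of_sq_le_sq' (show (Q.1 - a) ^ 2 ≤ r ^ 2 by nlinarith) hr
  have hlt : 0 < r ^ 2 - a ^ 2 := by nlinarith [h.right_fst_pos]
  rcases lt_or_ge 0 b with hb | hb
  · exact ⟨b, hb, by linarith⟩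
  · exact ⟨P.2 / 2, by positivity, by nlinarith⟩

lemma exists_isLeftEdge_of_axis {y : ℝ} (hy : 0 < y) (hmem : 0 < discForm a b r 0 y 1) :
    ∃ u : ℕ × ℕ, ∃ i N : ℕ, u.1 = 0 ∧ IsLeftEdge a b r u i N := by
  have hopen : IsOpen {z : ℝ | 0 < z ∧ 0 < discForm a b r 0 z 1} := by
    have : Continuous fun z => discForm a b r 0 z 1 := by unfold discForm; fun_prop
    exact isOpen_Ioi.inter (isOpen_Ioi.preimage this)
  obtain ⟨q, hq, hqmem⟩ := Rat.denseRange_cast.exists_mem_open hopen ⟨y, hy, hmem⟩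
  obtain ⟨u, i, hi, hu₁, hu₂⟩ := exists_nat_mul_rat_eq (p := 0) (q := q) le_rfl
    (by exact_mod_cast hq.le)
  have hi : (0 : ℝ) < i := by exact_mod_cast hi
  have hu : 0 < discForm a b r u.1 u.2 i := by
    rw [hu₁, hu₂, discForm_smul_one, Rat.cast_zero]
    positivity
  refine ⟨u, i, ⌈|a ^ 2 + b ^ 2 - r ^ 2| / discForm a b r u.1 u.2 i⌉₊, by simpa using hu₁,
    hu.le, ?_, Or.inr ⟨by simpa using hu₁, (div_le_iff₀ hu).1 (Nat.le_ceil _)⟩⟩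
  have : (0 : ℝ) < u.2 := by rw [hu₂]; exact mul_pos hi hq
  exact_mod_cast this

lemma IsRayPair.exists_isLeftEdge (hr : 0 ≤ r) (h : IsRayPair a b r P Q) {p q : ℚ}
    (hmem : 0 ≤ discForm a b r p q 1) (hpq : P.2 * p = P.1 * q) :
    ∃ u : ℕ × ℕ, ∃ i N : ℕ, IsLeftEdge a b r u i N ∧
      ∃ s : ℝ, 0 < s ∧ (u.1 : ℝ) = s * P.1 ∧ (u.2 : ℝ) = s * P.2 := by
  by_cases hside : ∀ z : ℝ × ℝ, 0 ≤ discForm a b r z.1 z.2 1 → P.1 * z.2 ≤ P.2 * z.1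
  · exact h.exists_isLeftEdge_of_tangent hr hmem hpq hside
  · push Not at hside
    obtain ⟨z, hzmem, hz⟩ := hside
    have hP := h.left_fst_eq_zero hzmem hz
    have hP₂ := h.left_snd_pos
    have hz₁ : z.1 < 0 := by
      rw [hP, zero_mul] at hz
      exact neg_of_mul_neg_right hz hP₂.le
    obtain ⟨y, hy, hymem⟩ := h.exists_discForm_axis_pos hr hP hzmem hz₁
    obtain ⟨u, i, N, hu, hedge⟩ := exists_isLeftEdge_of_axis hy hymem
    have := hedge.snd_pos
    exact ⟨u, i, N, hedge, u.2 / P.2, by positivity, by simp [hu, hP],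
      (div_mul_cancel₀ _ hP₂.ne').symm⟩

lemma IsRayPair.exists_isFrame (hr : 0 ≤ r) (h : IsRayPair a b r P Q) {p q p' q' : ℚ}
    (hmem : 0 ≤ discForm a b r p q 1) (hpq : P.2 * p = P.1 * q)
    (hmem' : 0 ≤ discForm a b r p' q' 1) (hpq' : Q.2 * p' = Q.1 * q') :
    ∃ (u : ℕ × ℕ) (i : ℕ) (v : ℕ × ℕ) (j N : ℕ), IsFrame a b r u i v j N ∧
      (∃ s : ℝ, 0 < s ∧ (u.1 : ℝ) = s * P.1 ∧ (u.2 : ℝ) = s * P.2) ∧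
      ∃ t : ℝ, 0 < t ∧ (v.1 : ℝ) = t * Q.1 ∧ (v.2 : ℝ) = t * Q.2 := by
  obtain ⟨u, i, N₁, hleft, s, hs, hu₁, hu₂⟩ := h.exists_isLeftEdge hr hmem hpq
  obtain ⟨v, j, N₂, hright, t, ht, hv₂, hv₁⟩ := h.swap.exists_isLeftEdge hr (p := q') (q := p')
    (by rwa [discForm_swap]) hpq'.symm
  have hdet : (u.1 : ℝ) * v.1 < u.2 * v.2 := by
    rw [hu₁, hu₂, hv₁, hv₂]
    calc s * P.1 * (t * Q.2) = s * t * (P.1 * Q.2) := by ring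
      _ < s * t * (P.2 * Q.1) := mul_lt_mul_of_pos_left h.slope_lt (by positivity)
      _ = s * P.2 * (t * Q.1) := by ring
  have hpolar : 0 < discPolar a b r u.1 u.2 i v.2 v.1 j :=
    discPolar_pos hleft.height_pos hright.height_pos hleft.mem
      (by rw [← discForm_swap]; exact hright.mem) hdet.ne
  set N₃ := ⌈|a ^ 2 + b ^ 2 - r ^ 2| / (2 * discPolar a b r u.1 u.2 i v.2 v.1 j)⌉₊
  refine ⟨u, i, v.swap, j, N₁ + N₂ + N₃, ⟨hleft.mono (by omega), hright.mono (by omega), ?_, ?_⟩,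
    ⟨s, hs, hu₁, hu₂⟩, t, ht, hv₁, hv₂⟩
  · rw [slopeDet, sub_pos]
    exact_mod_cast hdet
  · exact (div_le_iff₀ (mul_pos two_pos hpolar)).1 (Nat.ceil_le.1 (show N₃ ≤ _ by omega))

lemma HasRationalPoint.exists_discForm_nonneg (hr : 0 < r) {τ : Submodule ℝ Plane}
    (hτ : ∀ X : Plane, X ∈ τ ↔ P.2 * X 0 = P.1 * X 1) (h : HasRationalPoint (disc a b r ∩ τ)) :
    ∃ p q : ℚ, 0 ≤ discForm a b r p q 1 ∧ P.2 * p = P.1 * q := by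
  obtain ⟨p, q, hmem, hpq⟩ := h
  exact ⟨p, q, by simpa using (mem_disc_iff hr.le).1 hmem, by simpa using (hτ _).1 hpq⟩

lemma hasRationalPoint_of_mem_discSemigroup {hr : 0 < r} {τ : Submodule ℝ Plane} {n : ℕ × ℕ}
    (hn : n ∈ discSemigroup a b r hr) (hn0 : n ≠ 0) (hτ : latticePoint n ∈ τ) :
    HasRationalPoint (disc a b r ∩ τ) := by
  obtain ⟨i, hi, X, hX, hnX⟩ := exists_mem_disc_inter_quadrant hn hn0
  have hi : (i : ℝ) ≠ 0 := by exact_mod_cast hi.ne'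
  obtain ⟨h₀, h₁⟩ := latticePoint_eq_smul_iff.1 hnX
  refine ⟨n.1 / i, n.2 / i, ?_⟩
  have hXeq : (!₂[((n.1 / i : ℚ) : ℝ), ((n.2 / i : ℚ) : ℝ)] : Plane) = X :=
    PiLp.ext (Fin.forall_fin_two.2 ⟨by simp [h₀, hi], by simp [h₁, hi]⟩)
  rw [hXeq]
  exact ⟨hX.1, (τ.smul_mem_iff hi).1 (hnX ▸ hτ)⟩

lemma AreExtremalRays.exists_isFrame (hr : 0 < r) {τ₁ τ₂ : Submodule ℝ Plane}
    (h : AreExtremalRays a b r τ₁ τ₂) (h₁ : HasRationalPoint (disc a b r ∩ τ₁))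
    (h₂ : HasRationalPoint (disc a b r ∩ τ₂)) :
    ∃ (u : ℕ × ℕ) (i : ℕ) (v : ℕ × ℕ) (j N : ℕ), IsFrame a b r u i v j N ∧
      ∀ n ∈ integerCone a b r, (latticePoint n ∉ τ₁ → 0 < slopeDet u n) ∧
        (latticePoint n ∉ τ₂ → 0 < slopeDet n v) := by
  obtain ⟨P, Q, hray, hτ₁, hτ₂⟩ := h.exists_isRayPair hr
  obtain ⟨p, q, hmem, hpq⟩ := h₁.exists_discForm_nonneg hr hτ₁
  obtain ⟨p', q', hmem', hpq'⟩ := h₂.exists_discForm_nonneg hr hτ₂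
  obtain ⟨u, i, v, j, N, hframe, ⟨s, hs, hu₁, hu₂⟩, t, ht, hv₁, hv₂⟩ :=
    hray.exists_isFrame hr.le hmem hpq hmem' hpq'
  refine ⟨u, i, v, j, N, hframe, fun n hn => ?_⟩
  obtain ⟨hl, hrt⟩ := hray.nonneg_of_mem_integerCone hr hn
  simp only [hτ₁, hτ₂, latticePoint, Matrix.cons_val_zero, Matrix.cons_val_one]
  constructor <;> intro hne
  · have : (0 : ℝ) < u.2 * n.1 - u.1 * n.2 := by
      rw [hu₁, hu₂, mul_assoc, mul_assoc, ← mul_sub]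
      exact mul_pos hs (hl.lt_of_ne' (sub_ne_zero.2 hne))
    rw [slopeDet]
    exact_mod_cast this
  · have : (0 : ℝ) < n.2 * v.1 - n.1 * v.2 := by
      rw [hv₁, hv₂,
        show (n.2 : ℝ) * (t * Q.1) - n.1 * (t * Q.2) = t * (Q.1 * n.2 - Q.2 * n.1) by ring]
      exact mul_pos ht (hrt.lt_of_ne' (sub_ne_zero.2 (Ne.symm hne)))
    rw [slopeDet]
    exact_mod_cast this

end RationalPoints

section FiniteGeneration

variable {a b r : ℝ} {P Q : ℝ × ℝ}

lemma exists_pos_mul_le_of_mem_closure {G : Set (ℕ × ℕ)} (hG : G.Finite) {c d : ℝ}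
    (hpos : ∀ g ∈ G, g ≠ 0 → 0 < c * g.1 - d * g.2) :
    ∃ e > 0, ∀ n ∈ AddSubmonoid.closure G, e * ((n.1 : ℝ) + n.2) ≤ c * n.1 - d * n.2 := by
  have hsmall : ∀ g ∈ G, ∀ᶠ e : ℝ in 𝓝[>] 0, e * ((g.1 : ℝ) + g.2) ≤ c * g.1 - d * g.2 := by
    intro g hg
    rcases eq_or_ne g 0 with rfl | hg0
    · simp
    · have : Tendsto (fun e : ℝ => e * ((g.1 : ℝ) + g.2)) (𝓝 0) (𝓝 0) :=
        Continuous.tendsto' (by fun_prop) _ _ (zero_mul _)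
      exact (this.eventually_le_const (hpos g hg hg0)).filter_mono nhdsWithin_le_nhds
  obtain ⟨e, heG, he⟩ := ((hG.eventually_all.2 hsmall).and self_mem_nhdsWithin).exists
  refine ⟨e, he, fun n hn => ?_⟩
  induction hn using AddSubmonoid.closure_induction with
  | mem g hg => exact heG g hg
  | zero => simp
  | add m n _ _ hm hn =>
    simp only [Prod.fst_add, Prod.snd_add, Nat.cast_add]
    linarith

lemma IsRayPair.exists_interior_near_left (h : IsRayPair a b r P Q) {e : ℝ} (he : 0 < e) :
    ∃ z : ℝ × ℝ, 0 < z.1 ∧ 0 < z.2 ∧ 0 < discForm a b r z.1 z.2 1 ∧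
      P.2 * z.1 - P.1 * z.2 < e * (z.1 + z.2) := by
  have hP₁ := h.left_nonneg.1
  have hP₂ := h.left_snd_pos
  have hQ₁ := h.right_fst_pos
  have hQ₂ := h.right_nonneg.2
  rw [Prod.fst_zero] at hP₁
  rw [Prod.snd_zero] at hQ₂
  let z : ℝ → ℝ × ℝ := fun t => ((1 - t) * P.1 + t * Q.1, (1 - t) * P.2 + t * Q.2)
  have hnear : ∀ᶠ t : ℝ in 𝓝 0,
      P.2 * (z t).1 - P.1 * (z t).2 < e * ((z t).1 + (z t).2) ∧ t < 1 := by
    have hleft : Tendsto (fun t => P.2 * (z t).1 - P.1 * (z t).2) (𝓝 0) (𝓝 0) :=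
      Continuous.tendsto' (by fun_prop) _ _ (by simp only [z]; ring)
    have hright : Tendsto (fun t => e * ((z t).1 + (z t).2)) (𝓝 0) (𝓝 (e * (P.1 + P.2))) :=
      Continuous.tendsto' (by fun_prop) _ _ (by simp only [z]; ring)
    exact (hleft.eventually_lt hright (by positivity)).and (eventually_lt_nhds one_pos)
  obtain ⟨t, ⟨hlt, ht1⟩, ht⟩ :=
    ((hnear.filter_mono nhdsWithin_le_nhds).and (self_mem_nhdsWithin (s := Set.Ioi 0))).exists
  have : 0 < t := ht
  have : 0 < 1 - t := sub_pos.2 ht1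
  have hdist : 0 < (P.1 - Q.1) ^ 2 + (P.2 - Q.2) ^ 2 := by
    by_contra hcon
    have h₁ : P.1 = Q.1 := by nlinarith
    have h₂ : P.2 = Q.2 := by nlinarith
    exact h.slope_lt.ne (by rw [h₁, h₂, mul_comm])
  refine ⟨z t, by positivity, by positivity, ?_, hlt⟩
  rw [discForm_convexComb]
  have := h.left_mem
  have := h.right_mem
  positivity

lemma IsRayPair.exists_mem_near_left {hr : 0 < r} (h : IsRayPair a b r P Q) {e : ℝ}
    (he : 0 < e) :
    ∃ n ∈ discSemigroup a b r hr, P.2 * n.1 - P.1 * n.2 < e * ((n.1 : ℝ) + n.2) := by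
  let U : Set (ℝ × ℝ) := {z | 0 < z.1 ∧ 0 < z.2 ∧ 0 < discForm a b r z.1 z.2 1 ∧
    P.2 * z.1 - P.1 * z.2 < e * (z.1 + z.2)}
  have hwedge : IsOpen {z : ℝ × ℝ | P.2 * z.1 - P.1 * z.2 < e * (z.1 + z.2)} :=
    isOpen_lt (by fun_prop) (by fun_prop)
  have hU : IsOpen U :=
    (isOpen_Ioi.preimage continuous_fst).inter <| (isOpen_Ioi.preimage continuous_snd).inter <|
      (isOpen_Ioi.preimage (continuous_discForm a b r 1)).inter hwedge
  obtain ⟨⟨p, q⟩, hp, hq, hmem, hlt⟩ :=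
    (Rat.denseRange_cast.prodMap Rat.denseRange_cast).exists_mem_open hU
      (h.exists_interior_near_left he)
  have hp : (0 : ℝ) < p := hp
  have hq : (0 : ℝ) < q := hq
  obtain ⟨n, i, hi, hn₁, hn₂⟩ := exists_nat_mul_rat_eq (p := p) (q := q)
    (by exact_mod_cast hp.le) (by exact_mod_cast hq.le)
  have hi : (0 : ℝ) < i := by exact_mod_cast hi
  refine ⟨n, mem_discSemigroup_iff.2 ⟨i, ?_⟩, ?_⟩
  · rw [hn₁, hn₂, discForm_smul_one_nonneg_iff hi]
    exact hmem.le
  · rw [hn₁, hn₂]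
    simp only [Prod.map_apply] at hlt
    nlinarith

lemma IsRayPair.exists_mem_left {hr : 0 < r} (h : IsRayPair a b r P Q)
    (hfg : (discSemigroup a b r hr).FG) :
    ∃ n ∈ discSemigroup a b r hr, n ≠ 0 ∧ P.2 * n.1 = P.1 * n.2 := by
  obtain ⟨G, hG, hfin⟩ := (AddSubmonoid.fg_iff _).1 hfg
  by_contra! hcon
  have hpos : ∀ g ∈ G, g ≠ 0 → 0 < P.2 * g.1 - P.1 * g.2 := by
    intro g hg hg0
    have hgS : g ∈ discSemigroup a b r hr := hG ▸ AddSubmonoid.subset_closure hg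
    exact (h.nonneg_of_mem_integerCone hr (discSemigroup_subset_integerCone hr hgS)).1.lt_of_ne'
      (sub_ne_zero.2 (hcon g hgS hg0))
  obtain ⟨e, he, hle⟩ := exists_pos_mul_le_of_mem_closure hfin hpos
  obtain ⟨n, hn, hlt⟩ := h.exists_mem_near_left (hr := hr) he
  exact hlt.not_ge (hle n (hG ▸ hn))

lemma AreExtremalRays.hasRationalPoint_left {hr : 0 < r} {τ₁ τ₂ : Submodule ℝ Plane}
    (h : AreExtremalRays a b r τ₁ τ₂) (hfg : (discSemigroup a b r hr).FG) :
    HasRationalPoint (disc a b r ∩ τ₁) := by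
  obtain ⟨P, Q, hray, hτ₁, -⟩ := h.exists_isRayPair hr
  obtain ⟨n, hn, hn0, hPn⟩ := hray.exists_mem_left hfg
  exact hasRationalPoint_of_mem_discSemigroup hn hn0 ((hτ₁ _).2 (by simpa [latticePoint] using hPn))

lemma AreExtremalRays.hasRationalPoint_right {hr : 0 < r} {τ₁ τ₂ : Submodule ℝ Plane}
    (h : AreExtremalRays a b r τ₁ τ₂) (hfg : (discSemigroup a b r hr).FG) :
    HasRationalPoint (disc a b r ∩ τ₂) := by
  obtain ⟨P, Q, hray, -, hτ₂⟩ := h.exists_isRayPair hr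
  obtain ⟨n, hn, hn0, hQn⟩ := hray.swap.exists_mem_left
    (map_prodComm_discSemigroup a b hr ▸ hfg.map _)
  rw [← map_prodComm_discSemigroup, AddSubmonoid.mem_map_equiv] at hn
  refine hasRationalPoint_of_mem_discSemigroup hn (fun h0 => hn0 (Prod.swap_injective h0))
    ((hτ₂ _).2 ?_)
  simpa [latticePoint] using hQn.symm

theorem AreExtremalRays.fg_iff (hr : 0 < r) {τ₁ τ₂ : Submodule ℝ Plane}
    (h : AreExtremalRays a b r τ₁ τ₂) : (discSemigroup a b r hr).FG ↔
      HasRationalPoint (disc a b r ∩ τ₁) ∧ HasRationalPoint (disc a b r ∩ τ₂) := by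
  refine ⟨fun hfg => ⟨h.hasRationalPoint_left hfg, h.hasRationalPoint_right hfg⟩, ?_⟩
  rintro ⟨h₁, h₂⟩
  obtain ⟨u, i, v, j, N, hframe, -⟩ := h.exists_isFrame hr h₁ h₂
  exact hframe.fg hr

theorem AreExtremalRays.finite_integerCone_diff {hr : 0 < r} {τ₁ τ₂ : Submodule ℝ Plane}
    (h : AreExtremalRays a b r τ₁ τ₂) (hfg : (discSemigroup a b r hr).FG) :
    {n | n ∈ integerCone a b r ∧ latticePoint n ∉ τ₁ ∧ latticePoint n ∉ τ₂ ∧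
      n ∉ discSemigroup a b r hr}.Finite := by
  obtain ⟨u, i, v, j, N, hframe, hinside⟩ :=
    h.exists_isFrame hr (h.hasRationalPoint_left hfg) (h.hasRationalPoint_right hfg)
  refine (Set.finite_Iic (frameBound u v N, frameBound u v N)).subset ?_
  rintro n ⟨hn, hn₁, hn₂, hnS⟩
  exact hframe.le_frameBound_of_not_mem ((hinside n hn).1 hn₁) ((hinside n hn).2 hn₂) hnS

end FiniteGeneration

section PrimitiveRecursion

variable {α β σ : Type*} [Primcodable α] [Primcodable β] [Primcodable σ]

attribute [fun_prop] Primrec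
attribute [fun_prop] Primrec.id Primrec.const Primrec.comp Primrec.fst Primrec.snd Primrec.pair

@[fun_prop]
lemma primrec_fst_comp {f : α → β × σ} (hf : Primrec f) : Primrec fun x => (f x).1 :=
  Primrec.fst.comp hf

@[fun_prop]
lemma primrec_snd_comp {f : α → β × σ} (hf : Primrec f) : Primrec fun x => (f x).2 :=
  Primrec.snd.comp hf

@[fun_prop]
lemma primrec_add {f g : α → ℕ} (hf : Primrec f) (hg : Primrec g) :
    Primrec fun x => f x + g x := Primrec.nat_add.comp hf hg

@[fun_prop]
lemma primrec_mul {f g : α → ℕ} (hf : Primrec f) (hg : Primrec g) :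
    Primrec fun x => f x * g x := Primrec.nat_mul.comp hf hg

@[fun_prop]
lemma primrec_sub {f g : α → ℕ} (hf : Primrec f) (hg : Primrec g) :
    Primrec fun x => f x - g x := Primrec.nat_sub.comp hf hg

@[fun_prop]
lemma primrec_cons {f : α → β} {g : α → List β} (hf : Primrec f) (hg : Primrec g) :
    Primrec fun x => f x :: g x := Primrec.list_cons.comp hf hg

lemma primrec_int_sub {f g : α → ℕ} (hf : Primrec f) (hg : Primrec g) :
    Primrec fun x => (f x : ℤ) - g x := by
  refine Primrec.encode_iff.1 (.of_eq (f := fun x => if g x ≤ f x then 2 * (f x - g x)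
    else 2 * (g x - f x) - 1) ?_ fun x => ?_)
  · exact .ite (Primrec.nat_le.comp hg hf) (by fun_prop) (by fun_prop)
  · split_ifs with h
    · rw [← Nat.cast_sub h]
      rfl
    · obtain ⟨d, hd⟩ := Nat.exists_eq_add_of_lt (not_le.1 h)
      rw [hd, show (f x : ℤ) - (f x + d + 1 : ℕ) = Int.negSucc d by omega]
      change _ = 2 * d + 1
      omega

lemma primrec_int_toNat : Primrec Int.toNat := by
  refine .of_eq (f := fun z : ℤ => if Encodable.encode z % 2 = 0 then Encodable.encode z / 2 else 0)
    (.ite (Primrec.eq.comp (Primrec.nat_mod.comp .encode (.const 2)) (.const 0))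
      (Primrec.nat_div.comp .encode (.const 2)) (.const 0)) fun z => ?_
  rcases z with n | n
  · change (if 2 * n % 2 = 0 then 2 * n / 2 else 0) = n
    rw [if_pos (by omega)]
    omega
  · change (if (2 * n + 1) % 2 = 0 then (2 * n + 1) / 2 else 0) = 0
    rw [if_neg (by omega)]

lemma primrec_int_toNat_neg : Primrec fun z : ℤ => (-z).toNat := by
  refine .of_eq (f := fun z : ℤ => if Encodable.encode z % 2 = 0 then 0
      else Encodable.encode z / 2 + 1)
    (.ite (Primrec.eq.comp (Primrec.nat_mod.comp .encode (.const 2)) (.const 0)) (.const 0)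
      (Primrec.succ.comp (Primrec.nat_div.comp .encode (.const 2)))) fun z => ?_
  rcases z with n | n
  · change (if 2 * n % 2 = 0 then 0 else 2 * n / 2 + 1) = (-(n : ℤ)).toNat
    rw [if_pos (by omega)]
    omega
  · change (if (2 * n + 1) % 2 = 0 then 0 else (2 * n + 1) / 2 + 1) = n + 1
    rw [if_neg (by omega)]
    omega

@[fun_prop]
lemma primrec_int_mul {f g : α → ℤ} (hf : Primrec f) (hg : Primrec g) :
    Primrec fun x => f x * g x := by
  have hf₁ := primrec_int_toNat.comp hf
  have hf₂ := primrec_int_toNat_neg.comp hf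
  have hg₁ := primrec_int_toNat.comp hg
  have hg₂ := primrec_int_toNat_neg.comp hg
  refine (primrec_int_sub (primrec_add (primrec_mul hf₁ hg₁) (primrec_mul hf₂ hg₂))
    (primrec_add (primrec_mul hf₁ hg₂) (primrec_mul hf₂ hg₁))).of_eq fun x => ?_
  conv_rhs => rw [← Int.toNat_sub_toNat_neg (f x), ← Int.toNat_sub_toNat_neg (g x)]
  push_cast
  ring

end PrimitiveRecursion

section PolynomialFamilies

/-- The product of two integer polynomials. -/
def IntPoly.mul (p q : IntPoly) : IntPoly :=
  p.flatMap fun m => q.map fun n => (m.1 * n.1, m.2.1 + n.2.1, m.2.2.1 + n.2.2.1, m.2.2.2 + n.2.2.2)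

lemma IntPoly.value_append (p q : IntPoly) (a b r : ℝ) :
    IntPoly.value (p ++ q) a b r = p.value a b r + q.value a b r := by
  rw [value, List.map_append, List.sum_append, value, value]

lemma IntPoly.value_mul (p q : IntPoly) (a b r : ℝ) :
    (p.mul q).value a b r = p.value a b r * q.value a b r := by
  induction p with
  | nil => simp [mul, value]
  | cons m p ih =>
    have hmonomial : IntPoly.value (q.map fun n =>
        (m.1 * n.1, m.2.1 + n.2.1, m.2.2.1 + n.2.2.1, m.2.2.2 + n.2.2.2)) a b r =
          m.1 * a ^ m.2.1 * b ^ m.2.2.1 * r ^ m.2.2.2 * q.value a b r := by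
      simp only [value, List.map_map, ← List.sum_map_mul_left, Function.comp_def]
      congr! 3
      push_cast
      ring
    rw [mul, List.flatMap_cons, value_append, ← mul, ih, hmonomial, ← add_mul]
    simp only [value, List.map_cons, List.sum_cons]

variable {α : Type*} [Primcodable α]

/-- A function of `(a, b, r)` and of an encodable parameter that is given by integer polynomials in
`(a, b, r)` which depend on the parameter in a primitive recursive way. -/
def IsPolynomialFamily (f : ℝ → ℝ → ℝ → α → ℝ) : Prop :=
  ∃ p : α → IntPoly, Primrec p ∧ ∀ a b r x, f a b r x = (p x).value a b r

namespace IsPolynomialFamily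

lemma coord_a : IsPolynomialFamily fun a _ _ (_ : α) => a :=
  ⟨fun _ => [(1, 1, 0, 0)], .const _, fun a b r x => by simp [IntPoly.value]⟩

lemma coord_b : IsPolynomialFamily fun _ b _ (_ : α) => b :=
  ⟨fun _ => [(1, 0, 1, 0)], .const _, fun a b r x => by simp [IntPoly.value]⟩

lemma coord_r : IsPolynomialFamily fun _ _ r (_ : α) => r :=
  ⟨fun _ => [(1, 0, 0, 1)], .const _, fun a b r x => by simp [IntPoly.value]⟩

lemma const (c : ℤ) : IsPolynomialFamily fun _ _ _ (_ : α) => (c : ℝ) :=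
  ⟨fun _ => [(c, 0, 0, 0)], .const _, fun a b r x => by simp [IntPoly.value]⟩

lemma zero : IsPolynomialFamily fun _ _ _ (_ : α) => 0 := by
  simpa only [Int.cast_zero] using const 0

lemma natCast {n : α → ℕ} (hn : Primrec n) : IsPolynomialFamily fun _ _ _ x => (n x : ℝ) := by
  refine ⟨fun x => [((n x : ℤ) - (0 : ℕ), 0, 0, 0)], ?_, fun a b r x => by simp [IntPoly.value]⟩
  have := primrec_int_sub hn (.const 0)
  fun_prop

variable {f g A B R X Y I X' Y' I' : ℝ → ℝ → ℝ → α → ℝ}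

lemma add (hf : IsPolynomialFamily f) (hg : IsPolynomialFamily g) :
    IsPolynomialFamily fun a b r x => f a b r x + g a b r x := by
  obtain ⟨p, hp, hpf⟩ := hf
  obtain ⟨q, hq, hqg⟩ := hg
  exact ⟨fun x => p x ++ q x, Primrec.list_append.comp hp hq, fun a b r x => by
    simp only [IntPoly.value_append, hpf, hqg]⟩

lemma mul (hf : IsPolynomialFamily f) (hg : IsPolynomialFamily g) :
    IsPolynomialFamily fun a b r x => f a b r x * g a b r x := by
  obtain ⟨p, hp, hpf⟩ := hf
  obtain ⟨q, hq, hqg⟩ := hg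
  refine ⟨fun x => (p x).mul (q x), ?_, fun a b r x => by
    simp only [IntPoly.value_mul, hpf, hqg]⟩
  refine Primrec.list_flatMap hp (Primrec.list_map (hq.comp Primrec.fst) ?_)
  have : Primrec fun z : (α × (ℤ × ℕ × ℕ × ℕ)) × (ℤ × ℕ × ℕ × ℕ) => (z.1.2.1 * z.2.1,
      z.1.2.2.1 + z.2.2.1, z.1.2.2.2.1 + z.2.2.2.1, z.1.2.2.2.2 + z.2.2.2.2) := by fun_prop
  exact this.to₂

lemma sub (hf : IsPolynomialFamily f) (hg : IsPolynomialFamily g) :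
    IsPolynomialFamily fun a b r x => f a b r x - g a b r x := by
  simpa only [Int.cast_neg, Int.cast_one, neg_one_mul, ← sub_eq_add_neg] using
    hf.add ((const (-1)).mul hg)

lemma sq (hf : IsPolynomialFamily f) : IsPolynomialFamily fun a b r x => f a b r x ^ 2 := by
  simpa only [pow_two] using hf.mul hf

lemma discPolar (hA : IsPolynomialFamily A) (hB : IsPolynomialFamily B)
    (hR : IsPolynomialFamily R) (hX : IsPolynomialFamily X) (hY : IsPolynomialFamily Y)
    (hI : IsPolynomialFamily I) (hX' : IsPolynomialFamily X') (hY' : IsPolynomialFamily Y')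
    (hI' : IsPolynomialFamily I') :
    IsPolynomialFamily fun a b r x => discPolar (A a b r x) (B a b r x) (R a b r x) (X a b r x)
      (Y a b r x) (I a b r x) (X' a b r x) (Y' a b r x) (I' a b r x) :=
  (((hI.mul hI').mul hR.sq).sub ((hX.sub (hI.mul hA)).mul (hX'.sub (hI'.mul hA)))).sub
    ((hY.sub (hI.mul hB)).mul (hY'.sub (hI'.mul hB)))

lemma discForm (hA : IsPolynomialFamily A) (hB : IsPolynomialFamily B)
    (hR : IsPolynomialFamily R) (hX : IsPolynomialFamily X) (hY : IsPolynomialFamily Y)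
    (hI : IsPolynomialFamily I) :
    IsPolynomialFamily fun a b r x => discForm (A a b r x) (B a b r x) (R a b r x) (X a b r x)
      (Y a b r x) (I a b r x) :=
  ((hI.sq.mul hR.sq).sub (hX.sub (hI.mul hA)).sq).sub (hY.sub (hI.mul hB)).sq

end IsPolynomialFamily

end PolynomialFamilies

section VerifiablePredicates

/-- The question that is asked at stage `m`. -/
def stageQuestion (m : ℕ) : IntPoly := (Encodable.decode m).getD []

/-- The answers to the first `m` questions, the latest one first. -/
noncomputable def stageAnswers (a b r : ℝ) : ℕ → List Bool
  | 0 => []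
  | m + 1 => (stageQuestion m).answer a b r :: stageAnswers a b r m

lemma length_stageAnswers (a b r : ℝ) (m : ℕ) : (stageAnswers a b r m).length = m := by
  induction m with
  | zero => rfl
  | succ m ih => rw [stageAnswers, List.length_cons, ih]

lemma reverse_stageAnswers_getElem? (a b r : ℝ) (m j : ℕ) :
    (stageAnswers a b r m).reverse[j]? =
      if j < m then some ((stageQuestion j).answer a b r) else none := by
  induction m with
  | zero => simp [stageAnswers]
  | succ m ih =>
    rw [stageAnswers, List.reverse_cons, List.getElem?_append, List.length_reverse,
      length_stageAnswers, ih]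
    rcases lt_trichotomy j m with h | rfl | h
    · simp [h, Nat.lt_succ_of_lt h]
    · simp
    · simp [h.not_gt, show ¬ j < m + 1 by omega, show j - m ≠ 0 by omega]

variable {α β : Type*} [Primcodable α] [Primcodable β]

/-- The property `P` of `(a, b, r)` and of an encodable parameter can be verified from the answers
to finitely many of the questions whether `p(a, b, r) ≥ 0`: a primitive recursive test accepts only
parameters with the property `P`, and each of these once enough answers are known. -/
def IsVerifiable (P : ℝ → ℝ → ℝ → α → Prop) : Prop :=
  ∃ D : α → List Bool → Prop, PrimrecRel D ∧ ∀ a b r x,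
    (∀ m, D x (stageAnswers a b r m) → P a b r x) ∧
      (P a b r x → ∀ᶠ m in atTop, D x (stageAnswers a b r m))

namespace IsVerifiable

variable {P Q : ℝ → ℝ → ℝ → α → Prop} {f g : ℝ → ℝ → ℝ → α → ℝ}

lemma congr (hP : IsVerifiable P) (h : ∀ a b r x, P a b r x ↔ Q a b r x) : IsVerifiable Q :=
  (funext₃ fun a b r => funext fun x => propext (h a b r x) : P = Q) ▸ hP

lemma comp (hP : IsVerifiable P) {f : β → α} (hf : Primrec f) :
    IsVerifiable fun a b r x => P a b r (f x) := by
  obtain ⟨D, hD, h⟩ := hP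
  exact ⟨fun x => D (f x), hD.comp (hf.comp .fst) .snd, fun a b r x => h a b r (f x)⟩

lemma of_primrecPred {p : α → Prop} (hp : PrimrecPred p) : IsVerifiable fun _ _ _ x => p x :=
  ⟨fun x _ => p x, hp.comp .fst, fun _ _ _ _ => ⟨fun _ => id, fun hx => .of_forall fun _ => hx⟩⟩

lemma and (hP : IsVerifiable P) (hQ : IsVerifiable Q) :
    IsVerifiable fun a b r x => P a b r x ∧ Q a b r x := by
  obtain ⟨D, hD, h⟩ := hP
  obtain ⟨E, hE, k⟩ := hQ
  exact ⟨fun x l => D x l ∧ E x l, PrimrecPred.and hD hE, fun a b r x =>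
    ⟨fun m => And.imp ((h a b r x).1 m) ((k a b r x).1 m),
      fun hx => ((h a b r x).2 hx.1).and ((k a b r x).2 hx.2)⟩⟩

lemma or (hP : IsVerifiable P) (hQ : IsVerifiable Q) :
    IsVerifiable fun a b r x => P a b r x ∨ Q a b r x := by
  obtain ⟨D, hD, h⟩ := hP
  obtain ⟨E, hE, k⟩ := hQ
  exact ⟨fun x l => D x l ∨ E x l, PrimrecPred.or hD hE, fun a b r x =>
    ⟨fun m => Or.imp ((h a b r x).1 m) ((k a b r x).1 m), Or.rec
      (fun hx => ((h a b r x).2 hx).mono fun _ => Or.inl)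
      fun hx => ((k a b r x).2 hx).mono fun _ => Or.inr⟩⟩

lemma exists_param {P : ℝ → ℝ → ℝ → α × β → Prop} (hP : IsVerifiable P) :
    IsVerifiable fun a b r x => ∃ y, P a b r (x, y) := by
  obtain ⟨D, hD, h⟩ := hP
  refine ⟨fun x l => ∃ y ∈ (List.range l.length).filterMap (Encodable.decode (α := β)),
    D (x, y) l, ?_, fun a b r x => ⟨?_, ?_⟩⟩
  · have hsearch : PrimrecRel fun (y : β) (z : α × List Bool) => D (z.1, y) z.2 :=
      hD.comp (f := fun w : β × α × List Bool => (w.2.1, w.1)) (by fun_prop) (by fun_prop)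
    exact hsearch.exists_mem_list.comp (Primrec.listFilterMap
      (Primrec.list_range.comp (Primrec.list_length.comp .snd)) (Primrec.decode.comp .snd)) .id
  · rintro m ⟨y, -, hy⟩
    exact ⟨y, (h a b r (x, y)).1 m hy⟩
  · rintro ⟨y, hy⟩
    filter_upwards [(h a b r (x, y)).2 hy, eventually_gt_atTop (Encodable.encode y)] with m hm hym
    refine ⟨y, List.mem_filterMap.2 ⟨Encodable.encode y, ?_, Encodable.encodek y⟩, hm⟩
    rwa [length_stageAnswers, List.mem_range]

lemma forall_mem {P : ℝ → ℝ → ℝ → α → β → Prop} {L : α → List β} (hL : Primrec L)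
    (hP : IsVerifiable fun a b r (x : α × β) => P a b r x.1 x.2) :
    IsVerifiable fun a b r x => ∀ y ∈ L x, P a b r x y := by
  obtain ⟨D, hD, h⟩ := hP
  refine ⟨fun x l => ∀ y ∈ L x, D (x, y) l, ?_, fun a b r x => ⟨fun m hx y hy => ?_, fun hx => ?_⟩⟩
  · have htest : PrimrecRel fun (y : β) (z : α × List Bool) => D (z.1, y) z.2 :=
      hD.comp (f := fun w : β × α × List Bool => (w.2.1, w.1)) (by fun_prop) (by fun_prop)
    exact htest.forall_mem_list.comp (hL.comp .fst) .id
  · exact (h a b r (x, y)).1 m (hx y hy)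
  · exact (L x).finite_toSet.eventually_all.2 fun y hy => (h a b r (x, y)).2 (hx y hy)

lemma forall_lt {P : ℝ → ℝ → ℝ → α → ℕ → Prop} {N : α → ℕ} (hN : Primrec N)
    (hP : IsVerifiable fun a b r (x : α × ℕ) => P a b r x.1 x.2) :
    IsVerifiable fun a b r x => ∀ n < N x, P a b r x n :=
  (forall_mem (Primrec.list_range.comp hN) hP).congr fun _ _ _ _ => by simp only [List.mem_range]

lemma forall_le {P : ℝ → ℝ → ℝ → α → ℕ × ℕ → Prop} {N : α → ℕ × ℕ} (hN : Primrec N)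
    (hP : IsVerifiable fun a b r (x : α × ℕ × ℕ) => P a b r x.1 x.2) :
    IsVerifiable fun a b r x => ∀ n ≤ N x, P a b r x n := by
  refine (forall_lt (P := fun a b r x p => ∀ q < (N x).2 + 1, P a b r x (p, q))
    (N := fun x => (N x).1 + 1) (by fun_prop) (forall_lt (by fun_prop)
      (hP.comp (f := fun z : (α × ℕ) × ℕ => (z.1.1, z.1.2, z.2)) (by fun_prop)))).congr ?_
  intro a b r x
  simp only [Prod.forall, Prod.le_def, Order.lt_add_one_iff, and_imp]
  exact forall_congr' fun p => forall_comm

lemma answer_eq {p : α → IntPoly} (hp : Primrec p) (c : Bool) :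
    IsVerifiable fun a b r x => (p x).answer a b r = c := by
  refine ⟨fun x l => l.reverse[Encodable.encode (p x)]? = some c, ?_, fun a b r x => ⟨?_, ?_⟩⟩
  · exact Primrec.eq.comp (Primrec.list_getElem?.comp (Primrec.list_reverse.comp .snd)
      (Primrec.encode.comp (hp.comp .fst))) (.const _)
  · intro m
    beta_reduce
    rw [reverse_stageAnswers_getElem?, stageQuestion, Encodable.encodek]
    split_ifs with h <;> simp
  · rintro rfl
    filter_upwards [eventually_gt_atTop (Encodable.encode (p x))] with m hm
    rw [reverse_stageAnswers_getElem?, stageQuestion, Encodable.encodek, if_pos hm,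
      Option.getD_some]

lemma le (hf : IsPolynomialFamily f) (hg : IsPolynomialFamily g) :
    IsVerifiable fun a b r x => f a b r x ≤ g a b r x := by
  obtain ⟨p, hp, hpf⟩ := hg.sub hf
  refine (answer_eq hp true).congr fun a b r x => ?_
  rw [IntPoly.answer, ← hpf, decide_eq_true_iff, sub_nonneg]

lemma lt (hf : IsPolynomialFamily f) (hg : IsPolynomialFamily g) :
    IsVerifiable fun a b r x => f a b r x < g a b r x := by
  obtain ⟨p, hp, hpf⟩ := hf.sub hg
  refine (answer_eq hp false).congr fun a b r x => ?_
  rw [IntPoly.answer, ← hpf, decide_eq_false_iff_not, sub_nonneg, not_le]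

lemma abs_le (hf : IsPolynomialFamily f) (hg : IsPolynomialFamily g) :
    IsVerifiable fun a b r x => |f a b r x| ≤ g a b r x := by
  refine ((le (IsPolynomialFamily.zero.sub hg) hf).and (le hf hg)).congr fun a b r x => ?_
  rw [zero_sub, _root_.abs_le]

end IsVerifiable

end VerifiablePredicates

section UniversalProcedure

/-- The list to be tested at stage `m` is coded by `m` in such a way that each list is tested at
arbitrarily late stages. -/
def stageCandidate (m : ℕ) : List (ℕ × ℕ) := (Encodable.decode m.unpair.1).getD []

open Classical in
/-- The procedure that asks all questions, and outputs a candidate as soon as the test `D` accepts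
it. -/
noncomputable def searchProcedure (D : List (ℕ × ℕ) → List Bool → Prop) : Procedure := fun h =>
  if D (stageCandidate h.length) h then Sum.inr (stageCandidate h.length)
  else Sum.inl (stageQuestion h.length)

lemma computable_searchProcedure {D : List (ℕ × ℕ) → List Bool → Prop} (hD : PrimrecRel D) :
    Computable (searchProcedure D) := by
  classical
  have hcandidate : Primrec fun h : List Bool => stageCandidate h.length :=
    Primrec.option_getD.comp (Primrec.decode.comp (Primrec.fst.comp
      (Primrec.unpair.comp Primrec.list_length))) (.const _)
  have hquestion : Primrec fun h : List Bool => stageQuestion h.length :=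
    Primrec.option_getD.comp (Primrec.decode.comp Primrec.list_length) (.const _)
  exact (Primrec.ite (hD.comp hcandidate .id) (Primrec.sumInr.comp hcandidate)
    (Primrec.sumInl.comp hquestion)).to_comp

lemma exists_searchProcedure_outputs {D : List (ℕ × ℕ) → List Bool → Prop} {a b r : ℝ}
    (h : ∃ m, D (stageCandidate m) (stageAnswers a b r m)) :
    ∃ m, D (stageCandidate m) (stageAnswers a b r m) ∧
      (searchProcedure D).Outputs a b r (stageCandidate m) := by
  classical
  have hreach : ∀ m ≤ Nat.find h, (searchProcedure D).Reaches a b r (stageAnswers a b r m) := by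
    intro m
    induction m with
    | zero => exact fun _ => .start
    | succ m ih =>
      intro hm
      refine .ask _ (stageQuestion m) (ih (by omega)) ?_
      rw [searchProcedure, length_stageAnswers, if_neg (Nat.find_min h (by omega))]
  refine ⟨_, Nat.find_spec h, _, hreach _ le_rfl, ?_⟩
  rw [searchProcedure, length_stageAnswers, if_pos (Nat.find_spec h)]

theorem IsVerifiable.exists_procedure {P : ℝ → ℝ → ℝ → List (ℕ × ℕ) → Prop}
    (hP : IsVerifiable P) : ∃ M : Procedure, Computable M ∧
      ∀ a b r, (∃ l, P a b r l) → ∃ l, P a b r l ∧ M.Outputs a b r l := by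
  obtain ⟨D, hD, h⟩ := hP
  refine ⟨searchProcedure D, computable_searchProcedure hD, ?_⟩
  rintro a b r ⟨l, hl⟩
  have hex : ∃ m, D (stageCandidate m) (stageAnswers a b r m) := by
    obtain ⟨t, ht⟩ := eventually_atTop.1 ((h a b r l).2 hl)
    refine ⟨Nat.pair (Encodable.encode l) t, ?_⟩
    rw [stageCandidate, Nat.unpair_pair, Encodable.encodek, Option.getD_some]
    exact ht _ (Nat.right_le_pair _ _)
  obtain ⟨m, hm, hout⟩ := exists_searchProcedure_outputs hex
  exact ⟨_, (h a b r _).1 m hm, hout⟩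

end UniversalProcedure

section Certificates

lemma forall_discForm_neg_iff {a b r x y : ℝ} :
    (∀ i : ℕ, discForm a b r x y i < 0) ↔ ∃ T : ℕ, 0 ≤ a ^ 2 + b ^ 2 - r ^ 2 ∧
      2 * (x * a + y * b) ≤ T * (a ^ 2 + b ^ 2 - r ^ 2) ∧
        ∀ i < T + 1, discForm a b r x y i < 0 := by
  simp only [discForm_eq_height_mul_sub, sub_neg]
  set k := a ^ 2 + b ^ 2 - r ^ 2
  set s := x * a + y * b
  constructor
  · intro h
    have hk : 0 ≤ k := by
      by_contra! hk
      obtain ⟨i, hi⟩ := exists_nat_ge ((x ^ 2 + y ^ 2 - 2 * s) / -k)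
      rw [div_le_iff₀ (neg_pos.2 hk)] at hi
      have := h (i + 1)
      push_cast at this
      nlinarith
    suffices ∃ T : ℕ, 2 * s ≤ T * k from
      this.imp fun T hT => ⟨hk, hT, fun i _ => h i⟩
    rcases hk.eq_or_lt with hk | hk
    · refine ⟨0, ?_⟩
      by_contra! hs
      obtain ⟨i, hi⟩ := exists_nat_ge ((x ^ 2 + y ^ 2) / (2 * s))
      rw [← hk, mul_zero] at hs
      rw [div_le_iff₀ hs] at hi
      have := h i
      rw [← hk] at this
      linarith
    · exact ⟨⌈2 * s / k⌉₊, (div_le_iff₀ hk).1 (Nat.le_ceil _)⟩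
  · rintro ⟨T, hk, hT, h⟩ i
    rcases Nat.lt_or_ge i (T + 1) with hi | hi
    · exact h i hi
    · have hTi : (T : ℝ) ≤ i := by exact_mod_cast (Nat.le_succ T).trans hi
      have hslope : 2 * s - k * i ≤ 0 := by nlinarith
      have hnorm := h 0 T.succ_pos
      rw [Nat.cast_zero, zero_mul] at hnorm
      exact (mul_nonpos_of_nonneg_of_nonpos i.cast_nonneg hslope).trans_lt hnorm

lemma disc_inter_quadrant_eq_empty_iff {a b r : ℝ} (hr : 0 < r) :
    disc a b r ∩ quadrant = ∅ ↔
      a + r < 0 ∨ b + r < 0 ∨ a < 0 ∧ b < 0 ∧ 0 < a ^ 2 + b ^ 2 - r ^ 2 := by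
  constructor
  · intro h
    have hneg : ∀ x y : ℝ, 0 ≤ x → 0 ≤ y → discForm a b r x y 1 < 0 := by
      intro x y hx hy
      by_contra! hxy
      exact Set.eq_empty_iff_forall_notMem.1 h !₂[x, y]
        ⟨(mem_disc_iff hr.le).2 (by simpa using hxy), by simpa using hx, by simpa using hy⟩
    simp only [discForm, one_pow, one_mul] at hneg
    -- otherwise the point of the quadrant closest to the center lies in the disc
    by_contra! hcon
    obtain ⟨har, hbr, hab⟩ := hcon
    rcases lt_or_ge a 0 with ha | ha <;> rcases lt_or_ge b 0 with hb | hb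
    · nlinarith [hneg 0 0 le_rfl le_rfl, hab ha hb]
    · nlinarith [hneg 0 b le_rfl hb]
    · nlinarith [hneg a 0 ha le_rfl]
    · nlinarith [hneg a b ha hb]
  · intro h
    rw [Set.eq_empty_iff_forall_notMem]
    rintro X ⟨hX, hX0, hX1⟩
    rw [mem_disc_iff hr.le, discForm] at hX
    rcases h with h | h | ⟨ha, hb, hab⟩
    · nlinarith [sq_nonneg (X 1 - 1 * b)]
    · nlinarith [sq_nonneg (X 0 - 1 * a)]
    · nlinarith

lemma IsFrame.setOf_mem_eq_irreducibles_iff {a b r : ℝ} {hr : 0 < r} {u v : ℕ × ℕ} {i j N : ℕ}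
    (h : IsFrame a b r u i v j N) {l : List (ℕ × ℕ)} :
    {n | n ∈ l} = irreducibles (discSemigroup a b r hr) ↔
      (∀ n ∈ l, n ∈ irreducibles (discSemigroup a b r hr)) ∧
        ∀ n ≤ (frameBound u v N, frameBound u v N),
          n ∈ l ∨ n ∉ irreducibles (discSemigroup a b r hr) := by
  refine Set.Subset.antisymm_iff.trans (and_congr_right fun _ => ⟨fun hsub n _ => ?_, ?_⟩)
  · exact or_iff_not_imp_right.2 fun hn => hsub (not_not.1 hn)
  · exact fun hbox n hn => (hbox n (h.le_frameBound_of_mem_irreducibles hn)).resolve_right (· hn)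

namespace IsVerifiable

open IsPolynomialFamily

section Frame

variable {α : Type*} [Primcodable α] {A B : ℝ → ℝ → ℝ → α → ℝ} {u v : α → ℕ × ℕ} {i j N : α → ℕ}

lemma isLeftEdge (hA : IsPolynomialFamily A) (hB : IsPolynomialFamily B) (hu : Primrec u)
    (hi : Primrec i) (hN : Primrec N) : IsVerifiable fun a b r x =>
      IsLeftEdge (A a b r x) (B a b r x) r (u x) (i x) (N x) := by
  have hu₁ : IsPolynomialFamily fun _ _ _ x => ((u x).1 : ℝ) := natCast (by fun_prop)
  have hu₂ : IsPolynomialFamily fun _ _ _ x => ((u x).2 : ℝ) := natCast (by fun_prop)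
  have hq := hA.discForm hB coord_r hu₁ hu₂ (natCast hi)
  have hdet := (hu₂.mul hA).sub (hu₁.mul hB)
  have htangent := (le zero hdet).and (le (coord_r.sq.mul (hu₁.sq.add hu₂.sq)) hdet.sq)
  have hinterior := (of_primrecPred (Primrec.eq.comp (primrec_fst_comp hu) (.const 0))).and
    (abs_le ((hA.sq.add hB.sq).sub coord_r.sq) ((natCast hN).mul hq))
  refine ((le zero hq).and ((of_primrecPred (Primrec.nat_lt.comp (.const 0)
    (primrec_snd_comp hu))).and (htangent.or hinterior))).congr fun a b r x => ?_
  exact ⟨fun ⟨h₁, h₂, h₃⟩ => ⟨h₁, h₂, h₃⟩, fun ⟨h₁, h₂, h₃⟩ => ⟨h₁, h₂, h₃⟩⟩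

lemma isFrame (hu : Primrec u) (hi : Primrec i) (hv : Primrec v) (hj : Primrec j)
    (hN : Primrec N) : IsVerifiable fun a b r x => IsFrame a b r (u x) (i x) (v x) (j x) (N x) := by
  have hv' : Primrec fun x => (v x).swap := (primrec_snd_comp hv).pair (primrec_fst_comp hv)
  have hdet := Primrec.nat_lt.comp (primrec_mul (primrec_fst_comp hu) (primrec_snd_comp hv))
    (primrec_mul (primrec_snd_comp hu) (primrec_fst_comp hv))
  have hpolar := coord_a.discPolar coord_b coord_r (natCast (primrec_fst_comp hu))
    (natCast (primrec_snd_comp hu)) (natCast hi) (natCast (primrec_fst_comp hv))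
    (natCast (primrec_snd_comp hv)) (natCast hj)
  refine ((isLeftEdge coord_a coord_b hu hi hN).and
    ((isLeftEdge coord_b coord_a hv' hj hN).and ((of_primrecPred hdet).and
      (abs_le ((coord_a.sq.add coord_b.sq).sub coord_r.sq)
        ((natCast hN).mul ((const 2).mul hpolar)))))).congr fun a b r x => ?_
  have hiff : 0 < slopeDet (u x) (v x) ↔ (u x).1 * (v x).2 < (u x).2 * (v x).1 := by
    rw [slopeDet, sub_pos]
    norm_cast
  rw [← hiff, Int.cast_ofNat]
  exact ⟨fun ⟨h₁, h₂, h₃, h₄⟩ => ⟨h₁, h₂, h₃, h₄⟩, fun ⟨h₁, h₂, h₃, h₄⟩ => ⟨h₁, h₂, h₃, h₄⟩⟩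

end Frame

lemma r_pos {α : Type*} [Primcodable α] : IsVerifiable fun _ _ r (_ : α) => 0 < r :=
  lt zero coord_r

lemma mem_discSemigroup :
    IsVerifiable fun a b r n => ∃ hr : 0 < r, n ∈ discSemigroup a b r hr := by
  have hheight : IsVerifiable fun a b r (z : (ℕ × ℕ) × ℕ) => 0 ≤ discForm a b r z.1.1 z.1.2 z.2 :=
    le zero (coord_a.discForm coord_b coord_r (natCast (by fun_prop)) (natCast (by fun_prop))
      (natCast .snd))
  refine (r_pos.and (exists_param hheight)).congr ?_
  simp only [mem_discSemigroup_iff, exists_prop, implies_true]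

lemma notMem_discSemigroup :
    IsVerifiable fun a b r n => ∃ hr : 0 < r, n ∉ discSemigroup a b r hr := by
  have hx : IsPolynomialFamily fun _ _ _ (z : (ℕ × ℕ) × ℕ) => (z.1.1 : ℝ) := natCast (by fun_prop)
  have hy : IsPolynomialFamily fun _ _ _ (z : (ℕ × ℕ) × ℕ) => (z.1.2 : ℝ) := natCast (by fun_prop)
  have hk : IsPolynomialFamily fun a b r (_ : (ℕ × ℕ) × ℕ) => a ^ 2 + b ^ 2 - r ^ 2 :=
    (coord_a.sq.add coord_b.sq).sub coord_r.sq
  have hslope := le ((const 2).mul ((hx.mul coord_a).add (hy.mul coord_b)))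
    ((natCast .snd).mul hk)
  have hheights : IsVerifiable fun a b r (z : (ℕ × ℕ) × ℕ) =>
      ∀ i < z.2 + 1, discForm a b r z.1.1 z.1.2 i < 0 :=
    forall_lt (by fun_prop) (lt (coord_a.discForm coord_b coord_r (natCast (by fun_prop))
      (natCast (by fun_prop)) (natCast .snd)) zero)
  refine (r_pos.and (exists_param ((le zero hk).and (hslope.and hheights)))).congr fun a b r n => ?_
  simp only [mem_discSemigroup_iff, not_exists, not_le, forall_discForm_neg_iff, exists_prop,
    Int.cast_ofNat]

lemma eq_zero {α : Type*} [Primcodable α] {n : α → ℕ × ℕ} (hn : Primrec n) :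
    IsVerifiable fun _ _ _ x => n x = 0 :=
  of_primrecPred (Primrec.eq.comp hn (.const 0))

lemma ne_zero {α : Type*} [Primcodable α] {n : α → ℕ × ℕ} (hn : Primrec n) :
    IsVerifiable fun _ _ _ x => n x ≠ 0 :=
  of_primrecPred (Primrec.eq.comp hn (.const 0)).not

lemma mem_irreducibles :
    IsVerifiable fun a b r n => ∃ hr : 0 < r, n ∈ irreducibles (discSemigroup a b r hr) := by
  have hsub : Primrec fun z : (ℕ × ℕ) × ℕ × ℕ => z.1 - z.2 := by
    change Primrec fun z : (ℕ × ℕ) × ℕ × ℕ => (z.1.1 - z.2.1, z.1.2 - z.2.2)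
    fun_prop
  have hsplit : IsVerifiable fun a b r (n : ℕ × ℕ) => ∀ x ≤ n,
      ((∃ hr : 0 < r, x ∉ discSemigroup a b r hr) ∨ ∃ hr : 0 < r, n - x ∉ discSemigroup a b r hr) ∨
        x = 0 ∨ n - x = 0 :=
    forall_le .id (((notMem_discSemigroup.comp .snd).or (notMem_discSemigroup.comp hsub)).or
      ((eq_zero .snd).or (eq_zero hsub)))
  refine (mem_discSemigroup.and ((ne_zero .id).and hsplit)).congr fun a b r n => ?_
  rw [← exists_and_right]
  refine exists_congr fun hr => ?_
  simp only [mem_irreducibles_iff, hr, exists_true_left]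
  refine and_congr_right fun _ => and_congr_right fun _ => ⟨fun h x hx y hy hn => ?_, ?_⟩
  · simpa [hn, hx, hy] using h x (hn ▸ le_self_add)
  · intro h x hxn
    refine or_iff_not_imp_left.2 fun hS => ?_
    rw [not_or, not_not, not_not] at hS
    exact h x hS.1 _ hS.2
      (Prod.ext (add_tsub_cancel_of_le hxn.1).symm (add_tsub_cancel_of_le hxn.2).symm)

lemma notMem_irreducibles :
    IsVerifiable fun a b r n => ∃ hr : 0 < r, n ∉ irreducibles (discSemigroup a b r hr) := by
  have hsum : PrimrecPred fun z : ((ℕ × ℕ) × ℕ × ℕ) × ℕ × ℕ => z.1.1 = z.1.2 + z.2 :=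
    Primrec.eq.comp (by fun_prop) ((by fun_prop :
      Primrec fun z : ((ℕ × ℕ) × ℕ × ℕ) × ℕ × ℕ => (z.1.2.1 + z.2.1, z.1.2.2 + z.2.2)))
  have hsplit := exists_param <| exists_param <| (mem_discSemigroup.comp (.comp .snd .fst)).and <|
    (mem_discSemigroup.comp .snd).and <| (of_primrecPred hsum).and <|
      (ne_zero (.comp .snd .fst)).and (ne_zero .snd)
  refine (notMem_discSemigroup.or ((r_pos.and (eq_zero .id)).or hsplit)).congr fun a b r n => ?_
  by_cases hr : 0 < r
  · simp only [mem_irreducibles_iff, hr, exists_true_left, true_and]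
    grind
  · simp [hr]

lemma disc_inter_quadrant_eq_empty {α : Type*} [Primcodable α] :
    IsVerifiable fun a b r (_ : α) => ∃ _ : 0 < r, disc a b r ∩ quadrant = ∅ := by
  refine (r_pos.and ((lt (coord_a.add coord_r) zero).or ((lt (coord_b.add coord_r) zero).or
    ((lt coord_a zero).and ((lt coord_b zero).and
      (lt zero ((coord_a.sq.add coord_b.sq).sub coord_r.sq))))))).congr fun a b r _ => ?_
  rw [exists_prop]
  exact and_congr_right fun hr => (disc_inter_quadrant_eq_empty_iff hr).symm

section Frame

variable {α : Type*} [Primcodable α] {l : α → List (ℕ × ℕ)} {u v : α → ℕ × ℕ} {i j N : α → ℕ}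

lemma isFrame_and_setOf_mem_eq_irreducibles (hl : Primrec l) (hu : Primrec u) (hi : Primrec i)
    (hv : Primrec v) (hj : Primrec j) (hN : Primrec N) :
    IsVerifiable fun a b r x => ∃ hr : 0 < r, IsFrame a b r (u x) (i x) (v x) (j x) (N x) ∧
      {n | n ∈ l x} = irreducibles (discSemigroup a b r hr) := by
  have hbound : Primrec fun x => frameBound (u x) (v x) (N x) := by
    simp only [frameBound]
    fun_prop
  have hmem : PrimrecPred fun z : α × ℕ × ℕ => ∃ n ∈ l z.1, n = z.2 :=
    Primrec.eq.exists_mem_list.comp (hl.comp .fst) .snd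
  have hlist : IsVerifiable fun a b r x =>
      ∀ n ∈ l x, ∃ hr : 0 < r, n ∈ irreducibles (discSemigroup a b r hr) :=
    forall_mem hl (mem_irreducibles.comp .snd)
  have hbox : IsVerifiable fun a b r x =>
      ∀ n ≤ (frameBound (u x) (v x) (N x), frameBound (u x) (v x) (N x)),
        (∃ m ∈ l x, m = n) ∨ ∃ hr : 0 < r, n ∉ irreducibles (discSemigroup a b r hr) :=
    forall_le (by fun_prop) ((of_primrecPred hmem).or (notMem_irreducibles.comp .snd))
  refine (r_pos.and ((isFrame hu hi hv hj hN).and (hlist.and hbox))).congr fun a b r x => ?_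
  rw [← exists_prop]
  refine exists_congr fun hr => and_congr_right fun h => ?_
  simp only [h.setOf_mem_eq_irreducibles_iff, hr, exists_true_left, exists_eq_right]

end Frame

end IsVerifiable

theorem isVerifiable_setOf_mem_eq_irreducibles : IsVerifiable fun a b r (l : List (ℕ × ℕ)) =>
    ∃ hr : 0 < r, (disc a b r ∩ quadrant = ∅ ∨
      ∃ (u : ℕ × ℕ) (i : ℕ) (v : ℕ × ℕ) (j N : ℕ), IsFrame a b r u i v j N) ∧
        {n | n ∈ l} = irreducibles (discSemigroup a b r hr) := by
  have hnil : PrimrecPred fun l : List (ℕ × ℕ) => l = [] := Primrec.eq.comp .id (.const [])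
  have hframe := IsVerifiable.isFrame_and_setOf_mem_eq_irreducibles
    (α := List (ℕ × ℕ) × (ℕ × ℕ) × ℕ × (ℕ × ℕ) × ℕ × ℕ) (l := fun z => z.1)
    (u := fun z => z.2.1) (i := fun z => z.2.2.1) (v := fun z => z.2.2.2.1)
    (j := fun z => z.2.2.2.2.1) (N := fun z => z.2.2.2.2.2) (by fun_prop) (by fun_prop)
    (by fun_prop) (by fun_prop) (by fun_prop) (by fun_prop)
  refine ((IsVerifiable.disc_inter_quadrant_eq_empty.and (.of_primrecPred hnil)).or
    hframe.exists_param).congr fun a b r l => ?_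
  by_cases hr : 0 < r
  · simp only [hr, exists_true_left, or_and_right, Prod.exists, exists_and_right]
    refine or_congr_left (and_congr_right fun h => ?_)
    rw [discSemigroup_eq_bot hr h, irreducibles_bot, List.eq_nil_iff_forall_not_mem,
      Set.eq_empty_iff_forall_notMem]
    rfl
  · simp [hr]

end Certificates

theorem mainTheorem2 :
    (∀ (a b r : ℝ) (hr : 0 < r),
      (disc a b r ∩ quadrant = ∅ → discSemigroup a b r hr = ⊥) ∧
      ∀ τ₁ τ₂ : Submodule ℝ Plane, AreExtremalRays a b r τ₁ τ₂ →
        ((discSemigroup a b r hr).FG ↔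
          HasRationalPoint (disc a b r ∩ τ₁) ∧ HasRationalPoint (disc a b r ∩ τ₂)) ∧
        ((discSemigroup a b r hr).FG →
          (discSemigroup a b r hr : Set (ℕ × ℕ)) ⊆ integerCone a b r ∧
          {n | n ∈ integerCone a b r ∧ latticePoint n ∉ τ₁ ∧ latticePoint n ∉ τ₂ ∧
            n ∉ discSemigroup a b r hr}.Finite)) ∧
    ∃ M : Procedure, Computable M ∧
      ∀ (a b r : ℝ) (hr : 0 < r),
        (disc a b r ∩ quadrant = ∅ ∨ ∃ τ₁ τ₂ : Submodule ℝ Plane, AreExtremalRays a b r τ₁ τ₂) →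
        (discSemigroup a b r hr).FG →
        ∃ l : List (ℕ × ℕ), M.Outputs a b r l ∧
          IsMinimalGeneratingSystem {n | n ∈ l} (discSemigroup a b r hr) := by
  refine ⟨fun a b r hr => ⟨discSemigroup_eq_bot hr, fun τ₁ τ₂ h => ⟨h.fg_iff hr, fun hfg =>
    ⟨discSemigroup_subset_integerCone hr, h.finite_integerCone_diff hfg⟩⟩⟩, ?_⟩
  obtain ⟨M, hM, hMout⟩ := isVerifiable_setOf_mem_eq_irreducibles.exists_procedure
  refine ⟨M, hM, fun a b r hr hscope hfg => ?_⟩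
  have hframe : disc a b r ∩ quadrant = ∅ ∨
      ∃ (u : ℕ × ℕ) (i : ℕ) (v : ℕ × ℕ) (j N : ℕ), IsFrame a b r u i v j N := by
    refine hscope.imp_right ?_
    rintro ⟨τ₁, τ₂, h⟩
    obtain ⟨u, i, v, j, N, huv, -⟩ :=
      h.exists_isFrame hr (h.hasRationalPoint_left hfg) (h.hasRationalPoint_right hfg)
    exact ⟨u, i, v, j, N, huv⟩
  obtain ⟨l, ⟨_, _, hl⟩, hout⟩ := hMout a b r
    ⟨(finite_irreducibles hfg).toFinset.toList, hr, hframe, by simp⟩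
  exact ⟨l, hout, hl ▸ isMinimalGeneratingSystem_irreducibles hfg⟩
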